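/- \textbf{Setting.} For $i\in\{1,2\}$ let $G_i=\langle X_i\mid R_i\rangle$ be a finite group given by a finite presentation, $X_1^{\pm}\cap X_2^{\pm}=\emptyset$, let $\phi_i:A\to G_i$ be monomorphisms from a group $A$, and let $G=G_1*_AG_2$ be the amalgam. $A$ is identified with its images in $G_1,G_2,G$. Put $X=X_1\cup X_2$. A graph labelled with $X^{\pm}$ has vertices and directed edges; each edge $e$ has an initial vertex $\iota(e)$, a reverse edge $\bar e\ne e$ and a label with $lab(\bar e)=lab(e)^{-1}$; $\tau(e)=\iota(\bar e)$. It is well-labelled if two edges with the same initial vertex and label coincide. $Lab(\Gamma,v_0)\le G$ is the set of elements represented by labels of paths closed at $v_0$. An $X_i$-monochromatic component is a maximal connected subgraph labelled by $X_i^{\pm}$ with at least one edge. A vertex is bichromatic if edges with labels in $X_1^{\pm}$ and in $X_2^{\pm}$ start at it, and $X_i$-monochromatic if all edges that start at it have labels in $X_i^{\pm}$; $VB(C)$ and $VM_i(C)$ denote the vertices of $C$ that are bichromatic, respectively $X_i$-monochromatic, in $\Gamma$. For $S\le G_i$, $Cayley(G_i,S)$ has as vertices the right cosets $Sg$ and an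 edge labelled $x$ from $Sg$ to $Sgx$ for each $x\in X_i^{\pm}$; $Cayley(G_i)$ is the case $S=1$. A \emph{precover} of $G$ is a connected labelled graph in which every path whose label is trivial in $G$ is closed and each $X_i$-monochromatic component is isomorphic to some $Cayley(G_i,S)$. A monochromatic component $C$ of colour $i$ of a precover $(\Gamma,v_0)$ is \emph{redundant} if either (1) it is the only monochromatic component and $Lab(C,v_0)=1$, or (2) there are at least two monochromatic components and, for a vertex $\vartheta\in VB(C)$ and $K=Lab(C,\vartheta)$: $K\le A$, $VB(C)=\vartheta\cdot A$, and either $v_0\notin V(C)$, or $v_0\in VB(C)$ and $K=1$. A precover is \emph{reduced} if it has no redundant component and, whenever $v_0$ lies in a component $C$ of one colour with $Lab(C,v_0)\cap A\ne 1$, it lies in a component $D$ of the other colour with $Lab(C,v_0)\cap A=Lab(D,v_0)\cap A$. \textbf{Generalized Stallings algorithm.} Input: finitely many words $w_1,\dots,w_n$ over $X^{\pm}$ ($n\ge 0$); $H\le G$ is the subgroup generated by the elements they represent. A folding identifies two distinct edges with the same initial vertex and the same label. \begin{enumerate} \item $\Gamma_1$ is the bouquet of $n$ loops at $v_0$ labelled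 $w_1,\dots,w_n$. \item Fold edges and cut hairs (remove an edge whose terminal vertex is different from $v_0$ and has degree one, together with that vertex) as long as possible; the result is $\Gamma_2$. \item For each $X_i$-monochromatic component of $\Gamma_2$ ($i=1,2$), pick an edge $e$ of it, glue a copy of $Cayley(G_i)$ to the current graph by identifying $e$ with the edge of $Cayley(G_i)$ that starts at $1$ and has the same label, and fold as long as possible. The result is $\Gamma_3$. \item As long as possible, in any order: for a vertex $v\in VB(\Gamma_3)$ (more precisely its image in the current graph) and paths $p_1,p_2$ from $v$, labelled in $X_1^{\pm}$ and $X_2^{\pm}$ respectively, with $lab(p_1)=_Glab(p_2)\in A$ and $\tau(p_1)\ne\tau(p_2)$, identify $\tau(p_1)$ with $\tau(p_2)$; and fold edges. The result is $\Gamma_4$. \item As long as possible, remove (all edges and all $X_i$-monochromatic vertices of) an $X_i$-monochromatic component $C$ such that, for some $\vartheta\in VB(C)$ and $K\le A\cap G_i$, $(C,\vartheta)\cong(Cayley(G_i,K),K\cdot1)$, $|VB(C)|=[A:K]$, and either $K=1$ and $v_0\notin VM_i(C)$, or $K\neq1$ and $v_0\notin V(C)$. If the resulting graph $\Gamma$ has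 no bichromatic vertex and $(\Gamma,v_0)\cong (Cayley(G_i),1)$ for some $i$, let $\Gamma_5$ consist of the single vertex $v_0$ and no edges; otherwise $\Gamma_5=\Gamma$. \item If $v_0$ is an $X_i$-monochromatic vertex of $\Gamma_5$ that lies in an $X_i$-monochromatic component $C$ with $(C,v_0)\cong(Cayley(G_i,K),K\cdot 1)$ and $L=K\cap A\neq1$, glue $Cayley(G_j,L)$, $j\ne i$, to $\Gamma_5$ by identifying $L\cdot a$ with $v_0\cdot a$ for all $a\in A$. The result, or $\Gamma_5$ if the condition fails, is the output $(\Gamma(H),v_0)$. \end{enumerate} \textbf{Lemma.} For every input and whatever choices are made, the algorithm terminates (every execution is finite and does not stop before it has produced an output), and its output $(\Gamma(H),v_0)$ is a finite graph that is a reduced precover of $G$ with $Lab(\Gamma(H),v_0)=H$. -/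

import Mathlib

universe u v

namespace Stallings

/-! ## Labelled graphs

Throughout `X 0` and `X 1` are the (disjoint) generating sets of the two factors; the alphabet
is the disjoint union `Σ i, X i` together with formal inverses. -/

section Graphs

/-- The signed alphabet: `(⟨i, x⟩, true)` is `x ∈ X i` and `(⟨i, x⟩, false)` is its formal
inverse (the convention of `FreeGroup`). -/
abbrev Letter (X : Fin 2 → Type u) : Type u := (Σ i, X i) × Bool

variable {X : Fin 2 → Type u}

/-- The formal inverse of a letter. -/
def Letter.inv (l : Letter X) : Letter X := (l.1, !l.2)

/-- The index `i` such that the letter belongs to `X i` or to the inverses of `X i`. -/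
def Letter.color (l : Letter X) : Fin 2 := l.1.1

/-- A graph labelled with the signed alphabet: every edge `e` has an initial vertex `ini e`,
a reverse edge `rev e` and a label. That `rev e ≠ e` follows from the last axiom,
see `LGraph.rev_ne`. -/
structure LGraph (X : Fin 2 → Type u) where
  V : Type u
  E : Type u
  ini : E → V
  rev : E → E
  lab : E → Letter X
  rev_rev : ∀ e, rev (rev e) = e
  lab_rev : ∀ e, lab (rev e) = (lab e).inv

/-- A labelled graph with a basepoint. -/
structure PGraph (X : Fin 2 → Type u) extends LGraph X where
  base : V

namespace LGraph

variable (Γ : LGraph X)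

theorem rev_ne (e : Γ.E) : Γ.rev e ≠ e := by
  intro h
  have h1 := congrArg Prod.snd (Γ.lab_rev e)
  rw [h] at h1
  simp [Letter.inv] at h1

/-- The terminal vertex of an edge. -/
def ter (e : Γ.E) : Γ.V := Γ.ini (Γ.rev e)

/-- The colour (`0` or `1`) of an edge. -/
def color (e : Γ.E) : Fin 2 := (Γ.lab e).color

theorem color_rev (e : Γ.E) : Γ.color (Γ.rev e) = Γ.color e := by
  simp [color, Γ.lab_rev, Letter.inv, Letter.color]

/-- `Γ.HasPath a w b`: there is a path in `Γ` from `a` to `b` with label the word `w`. -/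
inductive HasPath : Γ.V → List (Letter X) → Γ.V → Prop
  | nil (a : Γ.V) : HasPath a [] a
  | cons (e : Γ.E) {w : List (Letter X)} {b : Γ.V} (h : HasPath (Γ.ter e) w b) :
      HasPath (Γ.ini e) (Γ.lab e :: w) b

/-- There is a path from `a` to `b` with label `w`, all of whose edges have colour `i`. -/
def HasMonoPath (i : Fin 2) (a : Γ.V) (w : List (Letter X)) (b : Γ.V) : Prop :=
  Γ.HasPath a w b ∧ ∀ l ∈ w, l.color = i

theorem HasPath.snoc {Γ : LGraph X} {a b : Γ.V} {w : List (Letter X)} (h : Γ.HasPath a w b)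
    (e : Γ.E) (he : Γ.ini e = b) : Γ.HasPath a (w ++ [Γ.lab e]) (Γ.ter e) := by
  induction h with
  | nil a => subst he; exact HasPath.cons e (HasPath.nil _)
  | cons f _ ih => exact HasPath.cons f (ih he)

/-- Any two vertices are joined by a path (and there is a vertex). -/
def Connected : Prop := Nonempty Γ.V ∧ ∀ a b : Γ.V, ∃ w, Γ.HasPath a w b

/-- No two distinct edges have the same initial vertex and the same label. -/
def WellLabelled : Prop :=
  ∀ e f : Γ.E, Γ.ini e = Γ.ini f → Γ.lab e = Γ.lab f → e = f

/-- The number of edges that start at a vertex. -/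
noncomputable def degree (a : Γ.V) : ℕ := {e : Γ.E | Γ.ini e = a}.ncard

/-- Edges of both colours start at `a`. -/
def Bichromatic (a : Γ.V) : Prop := ∀ i : Fin 2, ∃ e, Γ.ini e = a ∧ Γ.color e = i

/-- The set of bichromatic vertices. -/
def VB : Set Γ.V := {a | Γ.Bichromatic a}

/-- All edges that start at `a` have colour `i`. -/
def Monochromatic (i : Fin 2) (a : Γ.V) : Prop := ∀ e, Γ.ini e = a → Γ.color e = i

/-! ### Monochromatic components

A monochromatic component is a maximal connected subgraph all of whose edges have the same colour
and which has at least one edge. It is the component of any of its edges `e`. -/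

/-- The vertices of the monochromatic component of the edge `e`. -/
def compV (e : Γ.E) : Set Γ.V := {a | ∃ w, Γ.HasMonoPath (Γ.color e) (Γ.ini e) w a}

/-- The edges of the monochromatic component of the edge `e`. -/
def compE (e : Γ.E) : Set Γ.E := {f | Γ.color f = Γ.color e ∧ Γ.ini f ∈ Γ.compV e}

theorem rev_mem_compE {Γ : LGraph X} {e f : Γ.E} (hf : f ∈ Γ.compE e) :
    Γ.rev f ∈ Γ.compE e := by
  obtain ⟨hc, w, hw, hl⟩ := hf
  refine ⟨by rw [Γ.color_rev, hc], w ++ [Γ.lab f], hw.snoc f rfl, ?_⟩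
  intro l hmem
  rcases List.mem_append.1 hmem with h | h
  · exact hl l h
  · rw [List.mem_singleton.1 h]; exact hc

/-- The monochromatic component of the edge `e`, as a labelled graph. -/
def comp (e : Γ.E) : LGraph X where
  V := Γ.compV e
  E := Γ.compE e
  ini f := ⟨Γ.ini f.1, f.2.2⟩
  rev f := ⟨Γ.rev f.1, rev_mem_compE f.2⟩
  lab f := Γ.lab f.1
  rev_rev f := Subtype.ext (Γ.rev_rev f.1)
  lab_rev f := Γ.lab_rev f.1

/-- The bichromatic vertices of `Γ` that lie in the monochromatic component of `e`. -/
def compVB (e : Γ.E) : Set Γ.V := Γ.compV e ∩ Γ.VB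

/-- The vertices of the monochromatic component of `e` that are monochromatic in `Γ`
(of the colour of `e`). -/
def compVM (e : Γ.E) : Set Γ.V := {a | a ∈ Γ.compV e ∧ Γ.Monochromatic (Γ.color e) a}

/-- An isomorphism of labelled graphs. -/
structure Iso (Γ Δ : LGraph X) where
  onV : Γ.V ≃ Δ.V
  onE : Γ.E ≃ Δ.E
  ini_onE : ∀ e, Δ.ini (onE e) = onV (Γ.ini e)
  rev_onE : ∀ e, Δ.rev (onE e) = onE (Γ.rev e)
  lab_onE : ∀ e, Δ.lab (onE e) = Γ.lab e

/-! ### Operations on labelled graphs -/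

/-- The disjoint union of two labelled graphs. -/
def disjUnion (Γ Δ : LGraph X) : LGraph X where
  V := Γ.V ⊕ Δ.V
  E := Γ.E ⊕ Δ.E
  ini := Sum.map Γ.ini Δ.ini
  rev := Sum.map Γ.rev Δ.rev
  lab := Sum.elim Γ.lab Δ.lab
  rev_rev e := by cases e <;> simp [LGraph.rev_rev]
  lab_rev e := by cases e <;> simp [LGraph.lab_rev]

/-- The relation on vertices generating the identification of the edges `e` and `f`. -/
def EdgeRelV (e f : Γ.E) (a b : Γ.V) : Prop :=
  (a = Γ.ini e ∧ b = Γ.ini f) ∨ (a = Γ.ter e ∧ b = Γ.ter f)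

/-- The relation on edges generating the identification of the edges `e` and `f`. -/
def EdgeRelE (e f : Γ.E) (a b : Γ.E) : Prop :=
  (a = e ∧ b = f) ∨ (a = Γ.rev e ∧ b = Γ.rev f)

/-- The graph obtained by identifying two edges with the same label (together with their
reverse edges, their initial vertices and their terminal vertices). -/
def identEdges (e f : Γ.E) (h : Γ.lab e = Γ.lab f) : LGraph X where
  V := Quot (Γ.EdgeRelV e f)
  E := Quot (Γ.EdgeRelE e f)
  ini := Quot.map Γ.ini (by
    rintro a b (⟨rfl, rfl⟩ | ⟨rfl, rfl⟩)
    · exact Or.inl ⟨rfl, rfl⟩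
    · exact Or.inr ⟨rfl, rfl⟩)
  rev := Quot.map Γ.rev (by
    rintro a b (⟨rfl, rfl⟩ | ⟨rfl, rfl⟩)
    · exact Or.inr ⟨rfl, rfl⟩
    · exact Or.inl ⟨Γ.rev_rev _, Γ.rev_rev _⟩)
  lab := Quot.lift Γ.lab (by
    rintro a b (⟨rfl, rfl⟩ | ⟨rfl, rfl⟩)
    · exact h
    · rw [Γ.lab_rev, Γ.lab_rev, h])
  rev_rev e := by
    induction e using Quot.ind with
    | mk e => exact congrArg (Quot.mk _) (Γ.rev_rev e)
  lab_rev e := by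
    induction e using Quot.ind with
    | mk e => exact Γ.lab_rev e

/-- The graph obtained by identifying vertices that are related by `r`; the edges are kept. -/
def identVerts (r : Γ.V → Γ.V → Prop) : LGraph X where
  V := Quot r
  E := Γ.E
  ini e := Quot.mk r (Γ.ini e)
  rev := Γ.rev
  lab := Γ.lab
  rev_rev := Γ.rev_rev
  lab_rev := Γ.lab_rev

end LGraph

namespace PGraph

variable (Γ : PGraph X)

/-- The pair `e`, `f` can be folded: distinct edges with the same initial vertex and label. -/
structure Foldable (e f : Γ.E) : Prop where
  ne : e ≠ f
  ini_eq : Γ.ini e = Γ.ini f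
  lab_eq : Γ.lab e = Γ.lab f

/-- Stallings' folding of the edges `e` and `f`. -/
def fold (e f : Γ.E) (h : Γ.Foldable e f) : PGraph X :=
  { Γ.identEdges e f h.lab_eq with base := Quot.mk _ Γ.base }

/-- The image of an edge under a folding. -/
def foldE (e f : Γ.E) (h : Γ.Foldable e f) (a : Γ.E) : (Γ.fold e f h).E := Quot.mk _ a

/-- The image of a vertex under a folding. -/
def foldV (e f : Γ.E) (h : Γ.Foldable e f) (a : Γ.V) : (Γ.fold e f h).V := Quot.mk _ a

/-- The edge `e` is a hair: its terminal vertex is not the basepoint and has degree one. -/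
structure IsHair (e : Γ.E) : Prop where
  degree_eq : Γ.degree (Γ.ter e) = 1
  ter_ne : Γ.ter e ≠ Γ.base

theorem IsHair.eq_rev {Γ : PGraph X} {e : Γ.E} (h : Γ.IsHair e) {f : Γ.E}
    (hf : Γ.ini f = Γ.ter e) : f = Γ.rev e := by
  obtain ⟨g, hg⟩ := Set.ncard_eq_one.1 h.degree_eq
  have h1 : f ∈ ({g} : Set Γ.E) := hg ▸ hf
  have h2 : Γ.rev e ∈ ({g} : Set Γ.E) := hg ▸ (rfl : Γ.ini (Γ.rev e) = Γ.ter e)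
  rw [Set.mem_singleton_iff.1 h1, Set.mem_singleton_iff.1 h2]

/-- Cutting the hair `e`: the edge `e`, its reverse and its terminal vertex are removed. -/
def cutHair (e : Γ.E) (h : Γ.IsHair e) : PGraph X where
  V := {a : Γ.V // a ≠ Γ.ter e}
  E := {f : Γ.E // f ≠ e ∧ f ≠ Γ.rev e}
  ini f := ⟨Γ.ini f.1, fun hf => f.2.2 (h.eq_rev hf)⟩
  rev f := ⟨Γ.rev f.1, fun hf => f.2.2 ((Γ.rev_rev f.1).symm.trans (congrArg Γ.rev hf)), fun hf => f.2.1 (by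
    rw [← Γ.rev_rev f.1, hf, Γ.rev_rev])⟩
  lab f := Γ.lab f.1
  rev_rev f := Subtype.ext (Γ.rev_rev f.1)
  lab_rev f := Γ.lab_rev f.1
  base := ⟨Γ.base, fun hb => h.ter_ne hb.symm⟩

/-- The graph obtained by identifying the vertices `a` and `b`. -/
def identify (a b : Γ.V) : PGraph X :=
  { Γ.identVerts (fun c d => c = a ∧ d = b) with base := Quot.mk _ Γ.base }

/-- The image of a vertex under an identification of two vertices. -/
def identifyV (a b : Γ.V) (c : Γ.V) : (Γ.identify a b).V := Quot.mk _ c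

/-- Removing the monochromatic component of `e`: all its edges and all its vertices that are
monochromatic in `Γ` are removed, its bichromatic vertices are kept. -/
def removeComp (e : Γ.E) (h : Γ.base ∉ Γ.compVM e) : PGraph X where
  V := {a : Γ.V // a ∉ Γ.compVM e}
  E := {f : Γ.E // f ∉ Γ.compE e}
  ini f := ⟨Γ.ini f.1, fun hf => f.2 ⟨hf.2 f.1 rfl, hf.1⟩⟩
  rev f := ⟨Γ.rev f.1, fun hf => f.2 (by
    have := LGraph.rev_mem_compE hf
    rwa [Γ.rev_rev] at this)⟩
  lab f := Γ.lab f.1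
  rev_rev f := Subtype.ext (Γ.rev_rev f.1)
  lab_rev f := Γ.lab_rev f.1
  base := ⟨Γ.base, h⟩

/-- The pointed graph with one vertex and no edges. -/
def trivial (X : Fin 2 → Type u) : PGraph X where
  V := PUnit
  E := PEmpty
  ini e := e.elim
  rev e := e
  lab e := e.elim
  rev_rev e := e.elim
  lab_rev e := e.elim
  base := PUnit.unit

/-- The `k`-th vertex on the loop labelled by the `j`-th word; the first and the last
one are the basepoint `none`. -/
def bouquetNode (ws : List (List (Letter X))) (j : Fin ws.length) (k : ℕ) :
    Option {p : Fin ws.length × ℕ // 0 < p.2 ∧ p.2 < (ws.get p.1).length} :=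
  if h : 0 < k ∧ k < (ws.get j).length then some ⟨(j, k), h⟩ else none

/-- The bouquet of loops at a common basepoint labelled by the given words. The edge
`((j, k), true)` is the `k`-th edge of the `j`-th loop and `((j, k), false)` is its reverse. -/
def bouquet (ws : List (List (Letter X))) : PGraph X where
  V := ULift.{u} (Option {p : Fin ws.length × ℕ // 0 < p.2 ∧ p.2 < (ws.get p.1).length})
  E := ULift.{u} ((Σ j : Fin ws.length, Fin (ws.get j).length) × Bool)
  ini e := ⟨bouquetNode ws e.down.1.1
    (if e.down.2 then (e.down.1.2 : ℕ) else (e.down.1.2 : ℕ) + 1)⟩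
  rev e := ⟨(e.down.1, !e.down.2)⟩
  lab e := if e.down.2 then (ws.get e.down.1.1).get e.down.1.2
    else ((ws.get e.down.1.1).get e.down.1.2).inv
  rev_rev e := by
    rcases e with ⟨⟨p, b⟩⟩
    simp
  lab_rev e := by
    rcases e with ⟨⟨p, b⟩⟩
    cases b <;> simp [Letter.inv]
  base := ⟨none⟩

end PGraph

end Graphs

/-! ## Cayley graphs of the factors

The `i`-th factor is the group `PresentedGroup (R i) = gp⟨X i | R i⟩`. -/

section Cayley

variable {X : Fin 2 → Type u} (R : ∀ i, Set (FreeGroup (X i)))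

/-- The element of the `i`-th factor represented by a signed generator. -/
def genVal {i : Fin 2} (x : X i × Bool) : PresentedGroup (R i) :=
  if x.2 then PresentedGroup.of x.1 else (PresentedGroup.of x.1)⁻¹

theorem genVal_not {i : Fin 2} (x : X i × Bool) :
    genVal R (x.1, !x.2) = (genVal R x)⁻¹ := by
  rcases x with ⟨x, b⟩
  cases b <;> simp [genVal]

/-- The Cayley graph of the `i`-th factor: the edge `(g, x)` goes from `g` to `g x`. -/
def cayley (i : Fin 2) : LGraph X where
  V := PresentedGroup (R i)
  E := PresentedGroup (R i) × (X i × Bool)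
  ini e := e.1
  rev e := (e.1 * genVal R e.2, (e.2.1, !e.2.2))
  lab e := (⟨i, e.2.1⟩, e.2.2)
  rev_rev e := by simp [genVal_not]
  lab_rev e := rfl

variable {R}

/-- Right multiplication by `g` on the right cosets of `S`. -/
def cosetMul {i : Fin 2} (S : Subgroup (PresentedGroup (R i)))
    (c : Quotient (QuotientGroup.rightRel S)) (g : PresentedGroup (R i)) :
    Quotient (QuotientGroup.rightRel S) :=
  Quotient.map (fun h => h * g) (fun a b hab => by
    change QuotientGroup.rightRel S _ _ at hab
    change QuotientGroup.rightRel S _ _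
    rw [QuotientGroup.rightRel_apply] at hab ⊢
    simpa [mul_assoc] using hab) c

/-- The relative Cayley graph of the `i`-th factor with respect to the subgroup `S`: its vertices
are the right cosets `S g`, and the edge `(S g, x)` goes from `S g` to `S g x`. -/
def relCayley {i : Fin 2} (S : Subgroup (PresentedGroup (R i))) : LGraph X where
  V := Quotient (QuotientGroup.rightRel S)
  E := Quotient (QuotientGroup.rightRel S) × (X i × Bool)
  ini e := e.1
  rev e := (cosetMul S e.1 (genVal R e.2), (e.2.1, !e.2.2))
  lab e := (⟨i, e.2.1⟩, e.2.2)
  rev_rev e := by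
    rcases e with ⟨c, x⟩
    induction c using Quotient.inductionOn with
    | h g => simp [cosetMul, genVal_not]
  lab_rev e := rfl

/-- The vertex `S g` of the relative Cayley graph. -/
def coset {i : Fin 2} (S : Subgroup (PresentedGroup (R i))) (g : PresentedGroup (R i)) :
    (relCayley S).V :=
  Quotient.mk (QuotientGroup.rightRel S) g

/-- For a vertex `t` of the monochromatic component `C` of `e`: the pointed graph `(C, t)` is
isomorphic to `(Cayley(G_i, S), S · 1)`, where `i` is the colour of `e`. -/
def CompIso (Γ : LGraph X) (e : Γ.E) (t : Γ.V) (S : Subgroup (PresentedGroup (R (Γ.color e)))) :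
    Prop :=
  ∃ f : (Γ.comp e).Iso (relCayley S), ∃ ht : t ∈ Γ.compV e, f.onV ⟨t, ht⟩ = coset S 1

end Cayley

/-! ## Words in the amalgam, precovers, reduced precovers

The amalgam `G = G_1 *_A G_2` is `Monoid.PushoutI φ`. -/

section Precovers

variable {X : Fin 2 → Type u} {R : ∀ i, Set (FreeGroup (X i))} {A : Type v} [Group A]
  (φ : ∀ i, A →* PresentedGroup (R i))

/-- The element of the amalgam that a word represents. -/
def val (w : List (Letter X)) : Monoid.PushoutI φ :=
  FreeGroup.lift (fun s : Σ i, X i => Monoid.PushoutI.of (φ := φ) s.1 (PresentedGroup.of s.2))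
    (FreeGroup.mk w)

/-- The amalgamated subgroup `A` of `G`, as a set. -/
def amal : Set (Monoid.PushoutI φ) := Set.range (Monoid.PushoutI.base φ)

/-- `Lab(Γ, v₀)`: the elements of `G` represented by the labels of paths closed at `v₀`. -/
def Lab (Γ : PGraph X) : Set (Monoid.PushoutI φ) :=
  {g | ∃ w, Γ.HasPath Γ.base w Γ.base ∧ val φ w = g}

/-- `Lab(C, a)`, as a subset of `G`, where `C` is the monochromatic component of colour `i`
that contains `a`. -/
def monoLab (Γ : LGraph X) (i : Fin 2) (a : Γ.V) : Set (Monoid.PushoutI φ) :=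
  {g | ∃ w, Γ.HasMonoPath i a w a ∧ val φ w = g}

/-- The orbit `{a · g | g ∈ A}` of the vertex `a` in the monochromatic component of
colour `i` that contains `a`. -/
def orbit (Γ : LGraph X) (i : Fin 2) (a : Γ.V) : Set Γ.V :=
  {b | ∃ w, Γ.HasMonoPath i a w b ∧ val φ w ∈ amal φ}

/-- Every path whose label is trivial in `G` is closed. -/
def GBased (Γ : LGraph X) : Prop := ∀ a b w, Γ.HasPath a w b → val φ w = 1 → a = b

/-- A (connected) precover of `G`: a `G`-based graph each of whose monochromatic components of
colour `i` is isomorphic to a relative Cayley graph of the factor `G_i`. -/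
structure IsPrecover (Γ : LGraph X) : Prop where
  connected : Γ.Connected
  gBased : GBased φ Γ
  cover : ∀ e : Γ.E, ∃ S : Subgroup (PresentedGroup (R (Γ.color e))),
    Nonempty ((Γ.comp e).Iso (relCayley S))

/-- The monochromatic component of the edge `e` is redundant. -/
def Redundant (Γ : PGraph X) (e : Γ.E) : Prop :=
  ((∀ f, f ∈ Γ.compE e) ∧ monoLab φ Γ.toLGraph (Γ.color e) Γ.base = {1}) ∨
  ((∃ f, f ∉ Γ.compE e) ∧ ∃ t ∈ Γ.compVB e,
    monoLab φ Γ.toLGraph (Γ.color e) t ⊆ amal φ ∧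
    Γ.compVB e = orbit φ Γ.toLGraph (Γ.color e) t ∧
    (Γ.base ∉ Γ.compV e ∨
      (Γ.base ∈ Γ.compVB e ∧ monoLab φ Γ.toLGraph (Γ.color e) t = {1})))

/-- A reduced precover of `G`. -/
structure IsReducedPrecover (Γ : PGraph X) : Prop where
  precover : IsPrecover φ Γ.toLGraph
  not_redundant : ∀ e, ¬ Redundant φ Γ e
  base_cond : ∀ e : Γ.E, Γ.base ∈ Γ.compV e →
    monoLab φ Γ.toLGraph (Γ.color e) Γ.base ∩ amal φ ≠ {1} →
    ∃ f : Γ.E, Γ.color f ≠ Γ.color e ∧ Γ.base ∈ Γ.compV f ∧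
      monoLab φ Γ.toLGraph (Γ.color e) Γ.base ∩ amal φ =
        monoLab φ Γ.toLGraph (Γ.color f) Γ.base ∩ amal φ

end Precovers

/-! ## The generalized Stallings algorithm

The algorithm makes choices (which edges to fold, in which order to run through a set, ...),
so it is modelled by its transition relation on configurations; each maximal chain of
transitions is one execution. -/

section Algorithm

variable {X : Fin 2 → Type u} {R : ∀ i, Set (FreeGroup (X i))} {A : Type v} [Group A]
  (φ : ∀ i, A →* PresentedGroup (R i))

/-- The list contains exactly one edge of each monochromatic component, in some order. -/
def PicksEdges (Γ : LGraph X) (L : List Γ.E) : Prop :=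
  ∀ e : Γ.E, ∃! k : Fin L.length, L.get k ∈ Γ.compE e

/-- Step 3: glue a copy of the Cayley graph of the factor of the colour of `e` to `Γ` by
identifying `e` with the edge of the Cayley graph that starts at `1` and has the same label. -/
def glueCayley (R : ∀ i, Set (FreeGroup (X i))) (Γ : PGraph X) (e : Γ.E) : PGraph X :=
  { (Γ.toLGraph.disjUnion (cayley R (Γ.color e))).identEdges (Sum.inl e)
      (Sum.inr (1, ((Γ.lab e).1.2, (Γ.lab e).2))) rfl with
    base := Quot.mk _ (Sum.inl Γ.base) }

/-- The image of an edge of `Γ` after the gluing of step 3. -/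
def glueCayleyE (R : ∀ i, Set (FreeGroup (X i))) (Γ : PGraph X) (e a : Γ.E) :
    (glueCayley R Γ e).E := Quot.mk _ (Sum.inl a)

/-- Step 4: some paths `p₀` of colour `0` and `p₁` of colour `1`, which start at `c`, whose labels
are equal in `G` and lie in `A`, end at the distinct vertices `a` and `b`, respectively. -/
def Conflict (Γ : LGraph X) (c a b : Γ.V) : Prop :=
  a ≠ b ∧ ∃ w₀ w₁, Γ.HasMonoPath 0 c w₀ a ∧ Γ.HasMonoPath 1 c w₁ b ∧
    val φ w₀ ∈ amal φ ∧ val φ w₁ ∈ amal φ ∧ val φ w₀ = val φ w₁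

/-- Step 5: the component of `e` is to be removed. Here `K ≤ A` is a subgroup of the factor. -/
def Removable (Γ : PGraph X) (e : Γ.E) : Prop :=
  ∃ t ∈ Γ.compVB e, ∃ K : Subgroup (PresentedGroup (R (Γ.color e))),
    K ≤ (φ (Γ.color e)).range ∧ CompIso Γ.toLGraph e t K ∧
    (Γ.compVB e).ncard = K.relIndex (φ (Γ.color e)).range ∧
    ((K = ⊥ ∧ Γ.base ∉ Γ.compVM e) ∨ (K ≠ ⊥ ∧ Γ.base ∉ Γ.compV e))

theorem Removable.base_notMem {Γ : PGraph X} {e : Γ.E} (h : Removable φ Γ e) :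
    Γ.base ∉ Γ.compVM e := by
  obtain ⟨_, _, _, _, _, _, ⟨_, h⟩ | ⟨_, h⟩⟩ := h
  · exact h
  · exact fun hb => h hb.1

/-- End of step 5: no vertex is bichromatic and `(Γ, v₀)` is isomorphic to `(Cayley(G_i), 1)`. -/
def IsCayley (R : ∀ i, Set (FreeGroup (X i))) (Γ : PGraph X) : Prop :=
  Γ.VB = ∅ ∧ ∃ i, ∃ f : Γ.toLGraph.Iso (cayley R i), f.onV Γ.base = (1 : PresentedGroup (R i))

/-- Step 6, the test: the basepoint is monochromatic of the colour `i` of `e`, it lies in the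
component `C` of `e`, `(C, v₀)` is isomorphic to `(Cayley(G_i, K), K · 1)`, and `K ∩ A` is not
trivial. The intersection `K ∩ A` is taken in `A`. -/
def NeedsGlue (Γ : PGraph X) (e : Γ.E) (K : Subgroup (PresentedGroup (R (Γ.color e)))) : Prop :=
  Γ.Monochromatic (Γ.color e) Γ.base ∧ CompIso Γ.toLGraph e Γ.base K ∧
    K.comap (φ (Γ.color e)) ≠ ⊥

/-- Step 6, the relation on vertices: `v₀ · a` is identified with `L · a` for all `a ∈ A`.
Here `v₀ · a` is read in the component of colour `i`, and `L` is a subgroup of the factor `j`. -/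
def GlueRel (Γ : PGraph X) (i : Fin 2) {j : Fin 2} (L : Subgroup (PresentedGroup (R j)))
    (c d : (Γ.toLGraph.disjUnion (relCayley L)).V) : Prop :=
  ∃ (a : A) (b : Γ.V) (w : List (Letter X)), Γ.HasMonoPath i Γ.base w b ∧
    val φ w = Monoid.PushoutI.base φ a ∧ c = Sum.inl b ∧ d = Sum.inr (coset L (φ j a))

/-- Step 6, the gluing of `Cayley(G_j, L)`, along the `A`-orbit of the basepoint read in
colour `i`. -/
def glueRelCayley (Γ : PGraph X) (i : Fin 2) {j : Fin 2}
    (L : Subgroup (PresentedGroup (R j))) : PGraph X :=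
  { (Γ.toLGraph.disjUnion (relCayley L)).identVerts (GlueRel φ Γ i L) with
    base := Quot.mk _ (Sum.inl Γ.base) }

/-- The configurations of the algorithm: the step that is being executed and the current graph.
In step 3 the list consists of the (images of the) chosen edges of the components of `Γ₂` that
have not been processed yet; in step 4 the set is the image of the set of
bichromatic vertices of `Γ₃`. -/
inductive Config (X : Fin 2 → Type u) : Type (u + 1)
  | step2 (Γ : PGraph X)
  | step3 (Γ : PGraph X) (L : List Γ.E)
  | step4 (Γ : PGraph X) (B : Set Γ.V)
  | step5 (Γ : PGraph X)
  | step6 (Γ : PGraph X)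
  | output (Γ : PGraph X)

/-- The configuration after step 1. -/
def Config.start (ws : List (List (Letter X))) : Config X := .step2 (PGraph.bouquet ws)

/-- The transitions of the algorithm. -/
inductive Transition : Config X → Config X → Prop
  /- Step 2: fold edges and cut hairs as long as possible. -/
  | fold2 (Γ : PGraph X) (e f : Γ.E) (h : Γ.Foldable e f) :
      Transition (.step2 Γ) (.step2 (Γ.fold e f h))
  | cut2 (Γ : PGraph X) (e : Γ.E) (h : Γ.IsHair e) :
      Transition (.step2 Γ) (.step2 (Γ.cutHair e h))
  | end2 (Γ : PGraph X) (hw : Γ.WellLabelled) (hh : ∀ e, ¬ Γ.IsHair e)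
      (L : List Γ.E) (hL : PicksEdges Γ.toLGraph L) :
      Transition (.step2 Γ) (.step3 Γ L)
  /- Step 3: for each monochromatic component of `Γ₂`, glue a copy of the Cayley graph of the
  factor along the chosen edge, then fold as long as possible. -/
  | fold3 (Γ : PGraph X) (L : List Γ.E) (e f : Γ.E) (h : Γ.Foldable e f) :
      Transition (.step3 Γ L) (.step3 (Γ.fold e f h) (L.map (Γ.foldE e f h)))
  | glue3 (Γ : PGraph X) (e : Γ.E) (L : List Γ.E) (hw : Γ.WellLabelled) :
      Transition (.step3 Γ (e :: L)) (.step3 (glueCayley R Γ e) (L.map (glueCayleyE R Γ e)))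
  | end3 (Γ : PGraph X) (hw : Γ.WellLabelled) :
      Transition (.step3 Γ []) (.step4 Γ Γ.VB)
  /- Step 4: at the bichromatic vertices of `Γ₃`, identify the endpoints of pairs of paths of
  different colours with the same label in `A`, and fold, as long as possible; the order is
  arbitrary. -/
  | fold4 (Γ : PGraph X) (B : Set Γ.V) (e f : Γ.E) (h : Γ.Foldable e f) :
      Transition (.step4 Γ B) (.step4 (Γ.fold e f h) (Γ.foldV e f h '' B))
  | identify4 (Γ : PGraph X) (B : Set Γ.V) (c a b : Γ.V) (hc : c ∈ B)
      (h : Conflict φ Γ.toLGraph c a b) :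
      Transition (.step4 Γ B) (.step4 (Γ.identify a b) (Γ.identifyV a b '' B))
  | end4 (Γ : PGraph X) (B : Set Γ.V) (hw : Γ.WellLabelled)
      (h : ∀ c ∈ B, ∀ a b, ¬ Conflict φ Γ.toLGraph c a b) :
      Transition (.step4 Γ B) (.step5 Γ)
  /- Step 5: remove redundant components as long as possible; if what remains is the Cayley graph
  of a factor, replace it by the graph with one vertex and no edges. -/
  | remove5 (Γ : PGraph X) (e : Γ.E) (h : Removable φ Γ e) :
      Transition (.step5 Γ) (.step5 (Γ.removeComp e (h.base_notMem φ)))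
  | collapse5 (Γ : PGraph X) (h : ∀ e, ¬ Removable φ Γ e) (hc : IsCayley R Γ) :
      Transition (.step5 Γ) (.step6 (PGraph.trivial X))
  | end5 (Γ : PGraph X) (h : ∀ e, ¬ Removable φ Γ e) (hc : ¬ IsCayley R Γ) :
      Transition (.step5 Γ) (.step6 Γ)
  /- Step 6: if necessary, glue `Cayley(G_j, L)` at the basepoint, where `L = K ∩ A`. -/
  | glue6 (Γ : PGraph X) (e : Γ.E) (K : Subgroup (PresentedGroup (R (Γ.color e))))
      (h : NeedsGlue φ Γ e K) (j : Fin 2) (hj : j ≠ Γ.color e) :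
      Transition (.step6 Γ)
        (.output (glueRelCayley φ Γ (Γ.color e) ((K.comap (φ (Γ.color e))).map (φ j))))
  | end6 (Γ : PGraph X)
      (h : ∀ e (K : Subgroup (PresentedGroup (R (Γ.color e)))), ¬ NeedsGlue φ Γ e K) :
      Transition (.step6 Γ) (.output Γ)

/-- The configuration is reached in some execution on the input `ws`. -/
def Reachable (ws : List (List (Letter X))) (c : Config X) : Prop :=
  Relation.ReflTransGen (Transition φ) (Config.start ws) c

end Algorithm

end Stallings

/-! All choices of the algorithm are absorbed by an invariant of configurations, `Config.Invariant`:
the bouquet satisfies it (`sound_bouquet`), transitions preserve it (`Transition.invariant`), and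
for an output it yields the assertion. Executions are finite because a transition lowers,
lexicographically, the stage, the number of Cayley graphs still to be glued in step 3, and the size
of the graph (`Transition.rank_lt`).

The subgroup `H`. A potential, that is, a morphism to the coset graph of `H` with the basepoint
going to the coset `H`, forces the labels of closed paths into `H`. Foldings and identifications
merge only vertices with equal potential, and a potential extends over glued Cayley graphs by
translation. Conversely, closed paths for the input words survive every morphism. They also survive
the removal of a component: a path through it between bichromatic vertices has its value in `A`, so
it can be rerouted in the other colour (`Good.removeComp_exists_path`).

The precover property. After steps 3 and 4 every monochromatic component is a quotient of a Cayley
graph (`Cover`), and at bichromatic vertices the two actions of `A` agree (`NoConflict`). These two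
facts imply that paths with trivial label are closed (`Cover.gBased`). Cut such a path into
monochromatic pieces. By the normal form theorem for amalgams, if there are at least two pieces,
then two neighbours have the same colour or one of them lies in `A`; agreement of the actions allows
the two to be merged, and induction applies.

Reducedness. The component at `t` is the relative Cayley graph of the stabilizer of `t`
(`Cover.compIso`), so the tests of steps 5 and 6 become statements about stabilizers. A redundant
component of type (2) is removable (`Good.removable`), and one of type (1) means that the graph is
the Cayley graph of a factor, which is collapsed. At a bichromatic basepoint both stabilizers meet
`A` in the same subgroup. At a monochromatic one with nontrivial intersection, step 6 makes the
basepoint bichromatic without creating redundancy (`GlueData.not_redundant`). -/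

namespace Stallings

/-! ### Morphisms of labelled graphs, paths and monochromatic components. -/

section Morphisms

variable {X : Fin 2 → Type u}

/-- The letter of colour `i` given by a signed generator. -/
def letter (i : Fin 2) (x : X i × Bool) : Letter X := (⟨i, x.1⟩, x.2)

theorem letter_injective (i : Fin 2) : Function.Injective (letter (X := X) i) := by
  rintro ⟨x, b⟩ ⟨y, c⟩ h
  simp only [letter, Prod.mk.injEq, Sigma.mk.injEq, heq_eq_eq, true_and] at h
  rw [h.1, h.2]

theorem Letter.exists_eq {i : Fin 2} {l : Letter X} (h : l.color = i) :
    ∃ x : X i × Bool, l = letter i x := by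
  obtain ⟨⟨k, x⟩, b⟩ := l
  obtain rfl : k = i := h
  exact ⟨(x, b), rfl⟩

namespace LGraph

/-- A morphism of labelled graphs. -/
structure Hom (Γ Δ : LGraph X) where
  onV : Γ.V → Δ.V
  onE : Γ.E → Δ.E
  ini_onE : ∀ e, Δ.ini (onE e) = onV (Γ.ini e)
  rev_onE : ∀ e, Δ.rev (onE e) = onE (Γ.rev e)
  lab_onE : ∀ e, Δ.lab (onE e) = Γ.lab e

variable {Γ Δ : LGraph X}

theorem Hom.ter_onE (f : Γ.Hom Δ) (e : Γ.E) : Δ.ter (f.onE e) = f.onV (Γ.ter e) := by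
  rw [ter, f.rev_onE, f.ini_onE, ter]

theorem Hom.color_onE (f : Γ.Hom Δ) (e : Γ.E) : Δ.color (f.onE e) = Γ.color e := by
  rw [color, f.lab_onE, color]

/-- An isomorphism, regarded as a morphism. -/
def Iso.toHom (f : Γ.Iso Δ) : Γ.Hom Δ where
  onV := f.onV
  onE := f.onE
  ini_onE := f.ini_onE
  rev_onE := f.rev_onE
  lab_onE := f.lab_onE

/-- The inverse isomorphism. -/
def Iso.symm (f : Γ.Iso Δ) : Δ.Iso Γ where
  onV := f.onV.symm
  onE := f.onE.symm
  ini_onE e := by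
    obtain ⟨e, rfl⟩ := f.onE.surjective e
    rw [f.ini_onE, Equiv.symm_apply_apply, Equiv.symm_apply_apply]
  rev_onE e := by
    obtain ⟨e, rfl⟩ := f.onE.surjective e
    rw [f.rev_onE, Equiv.symm_apply_apply, Equiv.symm_apply_apply]
  lab_onE e := by
    obtain ⟨e, rfl⟩ := f.onE.surjective e
    rw [Equiv.symm_apply_apply, f.lab_onE]

/-- The composition of two isomorphisms. -/
def Iso.trans {Θ : LGraph X} (f : Γ.Iso Δ) (g : Δ.Iso Θ) : Γ.Iso Θ where
  onV := f.onV.trans g.onV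
  onE := f.onE.trans g.onE
  ini_onE e := by simp [g.ini_onE, f.ini_onE]
  rev_onE e := by simp [g.rev_onE, f.rev_onE]
  lab_onE e := by simp [g.lab_onE, f.lab_onE]

theorem ter_rev (e : Γ.E) : Γ.ter (Γ.rev e) = Γ.ini e := by
  rw [ter, Γ.rev_rev]

theorem HasPath.map (f : Γ.Hom Δ) {a b : Γ.V} {w : List (Letter X)} (h : Γ.HasPath a w b) :
    Δ.HasPath (f.onV a) w (f.onV b) := by
  induction h with
  | nil a => exact .nil _
  | cons e _ ih =>
    rw [← f.ini_onE, ← f.lab_onE]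
    exact .cons _ (by rwa [f.ter_onE])

theorem HasMonoPath.map (f : Γ.Hom Δ) {i : Fin 2} {a b : Γ.V} {w : List (Letter X)}
    (h : Γ.HasMonoPath i a w b) : Δ.HasMonoPath i (f.onV a) w (f.onV b) :=
  ⟨h.1.map f, h.2⟩

theorem HasPath.edge (e : Γ.E) : Γ.HasPath (Γ.ini e) [Γ.lab e] (Γ.ter e) :=
  .cons e (.nil _)

theorem HasPath.append {a b c : Γ.V} {w w' : List (Letter X)} (h : Γ.HasPath a w b)
    (h' : Γ.HasPath b w' c) : Γ.HasPath a (w ++ w') c := by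
  induction h with
  | nil a => exact h'
  | cons e _ ih => exact .cons e (ih h')

theorem HasPath.reverse {a b : Γ.V} {w : List (Letter X)} (h : Γ.HasPath a w b) :
    Γ.HasPath b (w.reverse.map Letter.inv) a := by
  induction h with
  | nil a => exact .nil _
  | cons e _ ih =>
    have := ih.append (HasPath.edge (Γ.rev e))
    rw [Γ.ter_rev, Γ.lab_rev] at this
    simpa using this

theorem HasMonoPath.append {i : Fin 2} {a b c : Γ.V} {w w' : List (Letter X)}
    (h : Γ.HasMonoPath i a w b) (h' : Γ.HasMonoPath i b w' c) : Γ.HasMonoPath i a (w ++ w') c :=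
  ⟨h.1.append h'.1, fun l hl => (List.mem_append.1 hl).elim (h.2 l) (h'.2 l)⟩

theorem HasMonoPath.reverse {i : Fin 2} {a b : Γ.V} {w : List (Letter X)}
    (h : Γ.HasMonoPath i a w b) : Γ.HasMonoPath i b (w.reverse.map Letter.inv) a := by
  refine ⟨h.1.reverse, fun l hl => ?_⟩
  obtain ⟨m, hm, rfl⟩ := List.mem_map.1 hl
  exact h.2 m (List.mem_reverse.1 hm)

theorem HasMonoPath.nil (i : Fin 2) (a : Γ.V) : Γ.HasMonoPath i a [] a :=
  ⟨.nil a, by simp⟩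

theorem HasMonoPath.edge {i : Fin 2} (e : Γ.E) (h : Γ.color e = i) :
    Γ.HasMonoPath i (Γ.ini e) [Γ.lab e] (Γ.ter e) :=
  ⟨.edge e, fun l hl => by rw [List.mem_singleton.1 hl]; exact h⟩

/-- An edge of colour `i` starts at `a`. -/
def Inc (Γ : LGraph X) (i : Fin 2) (a : Γ.V) : Prop := ∃ e, Γ.ini e = a ∧ Γ.color e = i

theorem Inc.map (f : Γ.Hom Δ) {i : Fin 2} {a : Γ.V} (h : Γ.Inc i a) : Δ.Inc i (f.onV a) := by
  obtain ⟨e, rfl, rfl⟩ := h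
  exact ⟨f.onE e, f.ini_onE e, f.color_onE e⟩

theorem mem_VB_of_ne {i j : Fin 2} (hij : i ≠ j) {a : Γ.V} (hi : Γ.Inc i a) (hj : Γ.Inc j a) :
    a ∈ Γ.VB := by
  intro k
  obtain rfl | rfl : k = i ∨ k = j := by omega
  · exact hi
  · exact hj

theorem HasMonoPath.inc_of_ne_nil {i : Fin 2} {a b : Γ.V} {w : List (Letter X)}
    (h : Γ.HasMonoPath i a w b) (hw : w ≠ []) : Γ.Inc i a := by
  obtain ⟨h, hl⟩ := h
  cases h with
  | nil => exact absurd rfl hw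
  | cons e _ => exact ⟨e, rfl, hl _ (List.mem_cons_self ..)⟩

theorem HasMonoPath.inc {i : Fin 2} {a b : Γ.V} {w : List (Letter X)}
    (h : Γ.HasMonoPath i a w b) (ha : Γ.Inc i a) : Γ.Inc i b := by
  rcases eq_or_ne w [] with rfl | hw
  · cases h.1; exact ha
  · exact h.reverse.inc_of_ne_nil (by simpa using hw)

theorem ini_mem_compV (e : Γ.E) : Γ.ini e ∈ Γ.compV e := ⟨[], .nil _ _⟩

theorem self_mem_compE (e : Γ.E) : e ∈ Γ.compE e := ⟨rfl, Γ.ini_mem_compV e⟩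

theorem compV_inc {e : Γ.E} {a : Γ.V} (h : a ∈ Γ.compV e) : Γ.Inc (Γ.color e) a :=
  h.choose_spec.inc ⟨e, rfl, rfl⟩

theorem compV_of_path {e : Γ.E} {a b : Γ.V} {w : List (Letter X)} (h : a ∈ Γ.compV e)
    (hp : Γ.HasMonoPath (Γ.color e) a w b) : b ∈ Γ.compV e :=
  ⟨_, h.choose_spec.append hp⟩

theorem exists_path_of_mem_compV {e : Γ.E} {a b : Γ.V} (ha : a ∈ Γ.compV e)
    (hb : b ∈ Γ.compV e) : ∃ w, Γ.HasMonoPath (Γ.color e) a w b :=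
  ⟨_, ha.choose_spec.reverse.append hb.choose_spec⟩

theorem ter_mem_compV {e f : Γ.E} (h : f ∈ Γ.compE e) : Γ.ter f ∈ Γ.compV e :=
  (rev_mem_compE h).2

theorem mem_compE_symm {e f : Γ.E} (h : f ∈ Γ.compE e) : e ∈ Γ.compE f :=
  ⟨h.1.symm, _, by rw [h.1]; exact h.2.choose_spec.reverse⟩

theorem mem_compE_trans {e f g : Γ.E} (h : f ∈ Γ.compE e) (h' : g ∈ Γ.compE f) :
    g ∈ Γ.compE e :=
  ⟨h'.1.trans h.1, compV_of_path h.2 (by rw [← h.1]; exact h'.2.choose_spec)⟩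

theorem compV_map (f : Γ.Hom Δ) {e : Γ.E} {a : Γ.V} (h : a ∈ Γ.compV e) :
    f.onV a ∈ Δ.compV (f.onE e) := by
  obtain ⟨w, h⟩ := h
  refine ⟨w, ?_⟩
  rw [f.ini_onE, f.color_onE]
  exact h.map f

/-- The inclusion of a monochromatic component. -/
def compHom (Γ : LGraph X) (e : Γ.E) : (Γ.comp e).Hom Γ where
  onV := Subtype.val
  onE := Subtype.val
  ini_onE _ := rfl
  rev_onE _ := rfl
  lab_onE _ := rfl

theorem HasMonoPath.lift_comp {e : Γ.E} {a b : Γ.V} {w : List (Letter X)}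
    (h : Γ.HasMonoPath (Γ.color e) a w b) (ha : a ∈ Γ.compV e) (hb : b ∈ Γ.compV e) :
    (Γ.comp e).HasPath ⟨a, ha⟩ w ⟨b, hb⟩ := by
  obtain ⟨h, hl⟩ := h
  induction h with
  | nil a => exact .nil _
  | cons f h ih =>
    have hf : f ∈ Γ.compE e := ⟨hl _ (List.mem_cons_self ..), ha⟩
    exact HasPath.cons (Γ := Γ.comp e) ⟨f, hf⟩
      (ih (ter_mem_compV hf) hb fun l hm => hl l (List.mem_cons_of_mem _ hm))

/-- The canonical morphism onto the graph with two edges identified. -/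
def identEdgesHom (Γ : LGraph X) (e f : Γ.E) (h : Γ.lab e = Γ.lab f) :
    Γ.Hom (Γ.identEdges e f h) where
  onV := Quot.mk _
  onE := Quot.mk _
  ini_onE _ := rfl
  rev_onE _ := rfl
  lab_onE _ := rfl

/-- The canonical morphism onto the graph with some vertices identified. -/
def identVertsHom (Γ : LGraph X) (r : Γ.V → Γ.V → Prop) : Γ.Hom (Γ.identVerts r) where
  onV := Quot.mk _
  onE := id
  ini_onE _ := rfl
  rev_onE _ := rfl
  lab_onE _ := rfl

/-- The inclusion of the first summand of a disjoint union. -/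
def inlHom (Γ Δ : LGraph X) : Γ.Hom (Γ.disjUnion Δ) where
  onV := Sum.inl
  onE := Sum.inl
  ini_onE _ := rfl
  rev_onE _ := rfl
  lab_onE _ := rfl

/-- The inclusion of the second summand of a disjoint union. -/
def inrHom (Γ Δ : LGraph X) : Δ.Hom (Γ.disjUnion Δ) where
  onV := Sum.inr
  onE := Sum.inr
  ini_onE _ := rfl
  rev_onE _ := rfl
  lab_onE _ := rfl

/-- The composition of two morphisms. -/
def Hom.comp {Θ : LGraph X} (g : Δ.Hom Θ) (f : Γ.Hom Δ) : Γ.Hom Θ where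
  onV := g.onV ∘ f.onV
  onE := g.onE ∘ f.onE
  ini_onE e := by simp [g.ini_onE, f.ini_onE]
  rev_onE e := by simp [g.rev_onE, f.rev_onE]
  lab_onE e := by simp [g.lab_onE, f.lab_onE]

theorem Connected.of_surjective (hΓ : Γ.Connected) (f : Γ.Hom Δ)
    (hf : Function.Surjective f.onV) : Δ.Connected := by
  refine ⟨hΓ.1.map f.onV, fun a b => ?_⟩
  obtain ⟨a, rfl⟩ := hf a
  obtain ⟨b, rfl⟩ := hf b
  exact (hΓ.2 a b).imp fun _ h => h.map f

theorem connected_of_base (v : Γ.V) (h : ∀ a, ∃ w, Γ.HasPath v w a) : Γ.Connected :=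
  ⟨⟨v⟩, fun a b => ⟨_, (h a).choose_spec.reverse.append (h b).choose_spec⟩⟩

end LGraph

end Morphisms

/-! ### Values of words, partial action of the factors on vertices, stabilizers. -/

section Values

variable {X : Fin 2 → Type u} {R : ∀ i, Set (FreeGroup (X i))} {A : Type v} [Group A]
  (φ : ∀ i, A →* PresentedGroup (R i))

open Monoid (PushoutI)

@[simp]
theorem val_nil : val φ [] = 1 := by simp [val, FreeGroup.lift_mk]

theorem val_append (w w' : List (Letter X)) : val φ (w ++ w') = val φ w * val φ w' := by
  simp [val, FreeGroup.lift_mk]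

theorem val_cons (l : Letter X) (w : List (Letter X)) : val φ (l :: w) = val φ [l] * val φ w :=
  val_append φ [l] w

theorem val_inv (l : Letter X) : val φ [l.inv] = (val φ [l])⁻¹ := by
  obtain ⟨x, b⟩ := l
  cases b <;> simp [val, FreeGroup.lift_mk, Letter.inv]

theorem val_reverse (w : List (Letter X)) :
    val φ (w.reverse.map Letter.inv) = (val φ w)⁻¹ := by
  induction w with
  | nil => simp
  | cons l w ih =>
    rw [val_cons, mul_inv_rev, ← ih, ← val_inv, ← val_append]
    simp

theorem val_letter (i : Fin 2) (x : X i × Bool) :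
    val φ [letter i x] = PushoutI.of (φ := φ) i (genVal R x) := by
  obtain ⟨x, b⟩ := x
  cases b <;> simp [val, FreeGroup.lift_mk, letter, genVal]

theorem exists_word (i : Fin 2) (g : PresentedGroup (R i)) :
    ∃ w : List (Letter X), (∀ l ∈ w, l.color = i) ∧ val φ w = PushoutI.of (φ := φ) i g := by
  induction g using PresentedGroup.induction_on with
  | _ z =>
    induction z using FreeGroup.induction_on with
    | C1 => exact ⟨[], by simp, by simp⟩
    | of x => exact ⟨[letter i (x, true)], by simp [letter, Letter.color], val_letter φ i _⟩
    | inv_of x _ =>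
      exact ⟨[letter i (x, false)], by simp [letter, Letter.color], by
        rw [val_letter]; simp [genVal, PresentedGroup.of]⟩
    | mul y z hy hz =>
      obtain ⟨w, hw, hv⟩ := hy
      obtain ⟨w', hw', hv'⟩ := hz
      refine ⟨w ++ w', fun l hl => (List.mem_append.1 hl).elim (hw l) (hw' l), ?_⟩
      rw [val_append, hv, hv', map_mul, map_mul]

theorem exists_of_eq_val {i : Fin 2} {w : List (Letter X)} (hw : ∀ l ∈ w, l.color = i) :
    ∃ g, val φ w = PushoutI.of (φ := φ) i g := by
  induction w with
  | nil => exact ⟨1, by simp⟩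
  | cons l w ih =>
    obtain ⟨g, hg⟩ := ih fun l hl => hw l (List.mem_cons_of_mem _ hl)
    obtain ⟨x, rfl⟩ := Letter.exists_eq (hw l (List.mem_cons_self ..))
    exact ⟨genVal R x * g, by rw [val_cons, val_letter, hg, map_mul]⟩

/-- Some path of colour `i` from `a` to `b` represents the element `g` of the `i`-th factor. -/
def Act (Γ : LGraph X) (i : Fin 2) (a : Γ.V) (g : PresentedGroup (R i)) (b : Γ.V) : Prop :=
  ∃ w, Γ.HasMonoPath i a w b ∧ val φ w = PushoutI.of (φ := φ) i g

variable {φ} {Γ Δ : LGraph X} {i : Fin 2} {a b c : Γ.V} {g h : PresentedGroup (R i)}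

theorem Act.refl (i : Fin 2) (a : Γ.V) : Act φ Γ i a 1 a := ⟨[], .nil _ _, by simp⟩

theorem Act.trans (H : Act φ Γ i a g b) (H' : Act φ Γ i b h c) : Act φ Γ i a (g * h) c := by
  obtain ⟨w, hw, hg⟩ := H
  obtain ⟨w', hw', hh⟩ := H'
  exact ⟨w ++ w', hw.append hw', by rw [val_append, hg, hh, map_mul]⟩

theorem Act.symm (H : Act φ Γ i a g b) : Act φ Γ i b g⁻¹ a := by
  obtain ⟨w, hw, hg⟩ := H
  exact ⟨_, hw.reverse, by rw [val_reverse, hg, map_inv]⟩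

theorem Act.edge (e : Γ.E) {x : X i × Bool} (hx : Γ.lab e = letter i x) :
    Act φ Γ i (Γ.ini e) (genVal R x) (Γ.ter e) :=
  ⟨[Γ.lab e], .edge e (by rw [LGraph.color, hx]; rfl), by rw [hx, val_letter]⟩

theorem Act.map (f : Γ.Hom Δ) (H : Act φ Γ i a g b) : Act φ Δ i (f.onV a) g (f.onV b) := by
  obtain ⟨w, hw, hg⟩ := H
  exact ⟨w, hw.map f, hg⟩

theorem Act.inc (H : Act φ Γ i a g b) (ha : Γ.Inc i a) : Γ.Inc i b :=
  H.choose_spec.1.inc ha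

theorem exists_act_of_path {w : List (Letter X)} (h : Γ.HasMonoPath i a w b) :
    ∃ g, Act φ Γ i a g b :=
  (exists_of_eq_val φ h.2).imp fun _ hg => ⟨w, h, hg⟩

theorem mem_compV_iff {e : Γ.E} : a ∈ Γ.compV e ↔ ∃ g, Act φ Γ (Γ.color e) (Γ.ini e) g a :=
  ⟨fun ⟨_, h⟩ => exists_act_of_path h, fun ⟨_, w, h, _⟩ => ⟨w, h⟩⟩

theorem exists_act_of_mem_compV {e : Γ.E} (ha : a ∈ Γ.compV e) (hb : b ∈ Γ.compV e) :
    ∃ g, Act φ Γ (Γ.color e) a g b :=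
  exists_act_of_path (LGraph.exists_path_of_mem_compV ha hb).choose_spec

theorem Act.mem_compV {e : Γ.E} {g : PresentedGroup (R (Γ.color e))}
    (H : Act φ Γ (Γ.color e) a g b) (ha : a ∈ Γ.compV e) : b ∈ Γ.compV e :=
  LGraph.compV_of_path ha H.choose_spec.1

/-- The factors embed in the amalgam, so only a nonempty path represents a nontrivial element. In
step 6 this shows that the basepoint has become bichromatic. -/
theorem Act.ne_one_inc (H : Act φ Γ i a g b) (hg : g ≠ 1) (hφ : ∀ i, Function.Injective (φ i)) :
    Γ.Inc i a := by
  obtain ⟨w, hw, hv⟩ := H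
  refine hw.inc_of_ne_nil ?_
  rintro rfl
  rw [val_nil, ← map_one (PushoutI.of i)] at hv
  exact hg (PushoutI.of_injective hφ i hv).symm

variable (φ) in
/-- The stabilizer of the vertex `a` in the `i`-th factor. -/
def stab (Γ : LGraph X) (i : Fin 2) (a : Γ.V) : Subgroup (PresentedGroup (R i)) where
  carrier := {g | Act φ Γ i a g a}
  mul_mem' h h' := h.trans h'
  one_mem' := .refl i a
  inv_mem' h := h.symm

theorem mem_stab : g ∈ stab φ Γ i a ↔ Act φ Γ i a g a := Iff.rfl

theorem mem_monoLab {z : PushoutI φ} :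
    z ∈ monoLab φ Γ i a ↔ ∃ g ∈ stab φ Γ i a, PushoutI.of (φ := φ) i g = z := by
  constructor
  · rintro ⟨w, hw, rfl⟩
    obtain ⟨g, hg⟩ := exists_of_eq_val φ hw.2
    exact ⟨g, ⟨w, hw, hg⟩, hg.symm⟩
  · rintro ⟨g, ⟨w, hw, hg⟩, rfl⟩
    exact ⟨w, hw, hg⟩

theorem of_mem_amal_iff (hφ : ∀ i, Function.Injective (φ i)) :
    PushoutI.of (φ := φ) i g ∈ amal φ ↔ g ∈ (φ i).range := by
  constructor
  · rintro ⟨x, hx⟩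
    rw [← PushoutI.of_apply_eq_base φ i] at hx
    exact ⟨x, PushoutI.of_injective hφ i hx⟩
  · rintro ⟨x, rfl⟩
    exact ⟨x, (PushoutI.of_apply_eq_base φ i x).symm⟩

theorem mem_orbit (hφ : ∀ i, Function.Injective (φ i)) :
    b ∈ orbit φ Γ i a ↔ ∃ x, Act φ Γ i a (φ i x) b := by
  constructor
  · rintro ⟨w, hw, hv⟩
    obtain ⟨g, hg⟩ := exists_of_eq_val φ hw.2
    rw [hg, of_mem_amal_iff hφ] at hv
    obtain ⟨x, rfl⟩ := hv
    exact ⟨x, w, hw, hg⟩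
  · rintro ⟨x, w, hw, hg⟩
    exact ⟨w, hw, by rw [hg, of_mem_amal_iff hφ]; exact ⟨x, rfl⟩⟩

theorem monoLab_subset_amal_iff (hφ : ∀ i, Function.Injective (φ i)) :
    monoLab φ Γ i a ⊆ amal φ ↔ stab φ Γ i a ≤ (φ i).range := by
  constructor
  · intro h g hg
    exact (of_mem_amal_iff hφ).1 (h (mem_monoLab.2 ⟨g, hg, rfl⟩))
  · rintro h _ hz
    obtain ⟨g, hg, rfl⟩ := mem_monoLab.1 hz
    exact (of_mem_amal_iff hφ).2 (h hg)

theorem monoLab_eq_one_iff (hφ : ∀ i, Function.Injective (φ i)) :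
    monoLab φ Γ i a = {1} ↔ stab φ Γ i a = ⊥ := by
  rw [Subgroup.eq_bot_iff_forall]
  constructor
  · intro h g hg
    have : PushoutI.of (φ := φ) i g ∈ ({1} : Set (PushoutI φ)) :=
      h ▸ mem_monoLab.2 ⟨g, hg, rfl⟩
    rw [Set.mem_singleton_iff, ← map_one (PushoutI.of i)] at this
    exact PushoutI.of_injective hφ i this
  · intro h
    ext z
    rw [mem_monoLab, Set.mem_singleton_iff]
    constructor
    · rintro ⟨g, hg, rfl⟩
      rw [h g hg, map_one]
    · rintro rfl
      exact ⟨1, one_mem _, map_one _⟩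

end Values

/-! ### Quotients of Cayley graphs; paths with trivial value via normal forms. -/

section Covers

variable {X : Fin 2 → Type u} {R : ∀ i, Set (FreeGroup (X i))} {A : Type v} [Group A]
  {φ : ∀ i, A →* PresentedGroup (R i)} {Γ Δ : LGraph X} {i j : Fin 2}

open Monoid (PushoutI)

/-- The map `m` is the restriction to the vertices of a morphism from the Cayley graph of
the `i`-th factor. -/
def IsOrbitMap (R : ∀ i, Set (FreeGroup (X i))) (Γ : LGraph X) (i : Fin 2)
    (m : PresentedGroup (R i) → Γ.V) : Prop :=
  ∀ g x, ∃ e, Γ.ini e = m g ∧ Γ.lab e = letter i x ∧ Γ.ter e = m (g * genVal R x)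

/-- Some morphism from the Cayley graph of the `i`-th factor maps `1` to `a`. -/
def CovAt (R : ∀ i, Set (FreeGroup (X i))) (Γ : LGraph X) (i : Fin 2) (a : Γ.V) : Prop :=
  ∃ m, IsOrbitMap R Γ i m ∧ m 1 = a

theorem IsOrbitMap.map {m : PresentedGroup (R i) → Γ.V} (hm : IsOrbitMap R Γ i m)
    (f : Γ.Hom Δ) : IsOrbitMap R Δ i (f.onV ∘ m) := by
  intro g x
  obtain ⟨e, h1, h2, h3⟩ := hm g x
  exact ⟨f.onE e, by rw [f.ini_onE, h1]; rfl, by rw [f.lab_onE, h2], by rw [f.ter_onE, h3]; rfl⟩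

theorem IsOrbitMap.translate {m : PresentedGroup (R i) → Γ.V} (hm : IsOrbitMap R Γ i m)
    (h : PresentedGroup (R i)) : IsOrbitMap R Γ i fun g => m (h * g) := by
  intro g x
  simpa only [mul_assoc] using hm (h * g) x

theorem IsOrbitMap.covAt {m : PresentedGroup (R i) → Γ.V} (hm : IsOrbitMap R Γ i m)
    (h : PresentedGroup (R i)) : CovAt R Γ i (m h) :=
  ⟨_, hm.translate h, by rw [mul_one]⟩

theorem CovAt.map {a : Γ.V} (h : CovAt R Γ i a) (f : Γ.Hom Δ) : CovAt R Δ i (f.onV a) := by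
  obtain ⟨m, hm, rfl⟩ := h
  exact ⟨_, hm.map f, rfl⟩

theorem IsOrbitMap.exists_path (φ : ∀ i, A →* PresentedGroup (R i))
    {m : PresentedGroup (R i) → Γ.V} (hm : IsOrbitMap R Γ i m)
    {w : List (Letter X)} (hw : ∀ l ∈ w, l.color = i) (h : PresentedGroup (R i)) :
    ∃ g, val φ w = PushoutI.of (φ := φ) i g ∧ Γ.HasPath (m h) w (m (h * g)) := by
  induction w generalizing h with
  | nil => exact ⟨1, by simp, by rw [mul_one]; exact .nil _⟩
  | cons l w ih =>
    obtain ⟨x, rfl⟩ := Letter.exists_eq (hw l (List.mem_cons_self ..))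
    obtain ⟨e, h1, h2, h3⟩ := hm h x
    obtain ⟨g, hg, hp⟩ := ih (fun l hl => hw l (List.mem_cons_of_mem _ hl)) (h * genVal R x)
    refine ⟨genVal R x * g, by rw [val_cons, val_letter, hg, map_mul], ?_⟩
    rw [← mul_assoc, ← h1, ← h2]
    exact .cons e (by rwa [h3])

theorem IsOrbitMap.act (hφ : ∀ i, Function.Injective (φ i)) {m : PresentedGroup (R i) → Γ.V}
    (hm : IsOrbitMap R Γ i m) (h g : PresentedGroup (R i)) :
    Act φ Γ i (m h) g (m (h * g)) := by
  obtain ⟨w, hw, hv⟩ := exists_word φ i g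
  obtain ⟨g', hg', hp⟩ := hm.exists_path φ hw h
  obtain rfl : g' = g := PushoutI.of_injective hφ i (hg'.symm.trans hv)
  exact ⟨w, ⟨hp, hw⟩, hv⟩

/-- In a well-labelled graph the edge supplied by the orbit map is the only one with its initial
vertex and label, so a path cannot leave the image of the Cayley graph. -/
theorem IsOrbitMap.exists_of_path (φ : ∀ i, A →* PresentedGroup (R i))
    (hΓ : Γ.WellLabelled) {m : PresentedGroup (R i) → Γ.V} (hm : IsOrbitMap R Γ i m)
    {a b : Γ.V} {w : List (Letter X)} (hw : Γ.HasMonoPath i a w b)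
    (h : PresentedGroup (R i)) (ha : a = m h) :
    ∃ g, val φ w = PushoutI.of (φ := φ) i g ∧ b = m (h * g) := by
  obtain ⟨hp, hl⟩ := hw
  induction hp generalizing h with
  | nil a => exact ⟨1, by simp, by rw [mul_one, ha]⟩
  | cons e hp ih =>
    obtain ⟨x, hx⟩ := Letter.exists_eq (hl _ (List.mem_cons_self ..))
    obtain ⟨f, h1, h2, h3⟩ := hm h x
    obtain rfl : e = f := hΓ _ _ (ha.trans h1.symm) (hx.trans h2.symm)
    obtain ⟨g, hg, hb⟩ := ih _ h3 (fun l hl' => hl l (List.mem_cons_of_mem _ hl'))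
    exact ⟨genVal R x * g, by rw [val_cons, h2, val_letter, hg, map_mul], by
      rw [hb, mul_assoc]⟩

theorem IsOrbitMap.act_iff (hφ : ∀ i, Function.Injective (φ i)) (hΓ : Γ.WellLabelled)
    {m : PresentedGroup (R i) → Γ.V} (hm : IsOrbitMap R Γ i m) {h g : PresentedGroup (R i)}
    {b : Γ.V} : Act φ Γ i (m h) g b ↔ b = m (h * g) := by
  constructor
  · rintro ⟨w, hw, hv⟩
    obtain ⟨g', hg', hp⟩ := hm.exists_of_path φ hΓ hw h rfl
    obtain rfl : g' = g := PushoutI.of_injective hφ i (hg'.symm.trans hv)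
    exact hp
  · rintro rfl
    exact hm.act hφ h g

theorem IsOrbitMap.eq_iff (hφ : ∀ i, Function.Injective (φ i)) (hΓ : Γ.WellLabelled)
    {m : PresentedGroup (R i) → Γ.V} (hm : IsOrbitMap R Γ i m) {h g : PresentedGroup (R i)} :
    m g = m h ↔ g * h⁻¹ ∈ stab φ Γ i (m 1) := by
  rw [mem_stab, hm.act_iff hφ hΓ, one_mul]
  constructor
  · intro H
    have h1 := hm.act hφ g h⁻¹
    rw [H, hm.act_iff hφ hΓ, mul_inv_cancel] at h1
    exact h1.symm
  · intro H
    have h1 := hm.act hφ (g * h⁻¹) h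
    rw [← H, hm.act_iff hφ hΓ, one_mul, inv_mul_cancel_right] at h1
    exact h1

theorem CovAt.of_path (hΓ : Γ.WellLabelled) {a b : Γ.V} {w : List (Letter X)}
    (h : CovAt R Γ i a) (hw : Γ.HasMonoPath i a w b) : CovAt R Γ i b := by
  obtain ⟨m, hm, rfl⟩ := h
  -- The statement involves no amalgam; the trivial group serves as the amalgamated subgroup, just
  -- to have values of words.
  have φ : ∀ i, Unit →* PresentedGroup (R i) := fun i => 1
  obtain ⟨g, -, rfl⟩ := hm.exists_of_path φ hΓ hw 1 rfl
  exact hm.covAt _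

variable (R) in
/-- A well-labelled graph all of whose monochromatic components are quotients of Cayley graphs. -/
structure Cover (Γ : LGraph X) : Prop where
  wl : Γ.WellLabelled
  covAt : ∀ i a, Γ.Inc i a → CovAt R Γ i a

theorem Cover.of_exists (hΓ : Γ.WellLabelled)
    (h : ∀ e, ∃ a ∈ Γ.compV e, CovAt R Γ (Γ.color e) a) : Cover R Γ := by
  refine ⟨hΓ, ?_⟩
  rintro _ _ ⟨e, rfl, rfl⟩
  obtain ⟨a, ⟨w, hw⟩, ha⟩ := h e
  exact ha.of_path hΓ hw.reverse

theorem Cover.total (hφ : ∀ i, Function.Injective (φ i)) (hΓ : Cover R Γ) {a : Γ.V}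
    (ha : Γ.Inc i a) (g : PresentedGroup (R i)) : ∃ b, Act φ Γ i a g b := by
  obtain ⟨m, hm, rfl⟩ := hΓ.covAt i a ha
  exact ⟨_, hm.act hφ _ _⟩

theorem Cover.eq_of_act_one (hφ : ∀ i, Function.Injective (φ i)) (hΓ : Cover R Γ) {a b : Γ.V}
    (h : Act φ Γ i a 1 b) : a = b := by
  have h' := h
  obtain ⟨w, hw, -⟩ := h'
  rcases eq_or_ne w [] with rfl | hne
  · cases hw.1; rfl
  · obtain ⟨m, hm, rfl⟩ := hΓ.covAt i a (hw.inc_of_ne_nil hne)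
    rw [hm.act_iff hφ hΓ.wl, mul_one] at h
    exact h.symm

theorem Cover.unique (hφ : ∀ i, Function.Injective (φ i)) (hΓ : Cover R Γ) {a b c : Γ.V}
    {g : PresentedGroup (R i)} (h : Act φ Γ i a g b) (h' : Act φ Γ i a g c) : b = c :=
  hΓ.eq_of_act_one hφ (by simpa using h.symm.trans h')

variable (φ) in
/-- At bichromatic vertices the actions of the amalgamated subgroup agree. -/
def NoConflict (Γ : LGraph X) : Prop :=
  ∀ d ∈ Γ.VB, ∀ i j x b c, i ≠ j → Act φ Γ i d (φ i x) b → Act φ Γ j d (φ j x) c → b = c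

/-- A piece with value in `A` may change its colour as soon as one of its ends carries the other
colour. If this is the terminal vertex, the agreement of the actions is applied there to the inverse
element. -/
theorem Cover.convert (hφ : ∀ i, Function.Injective (φ i)) (hΓ : Cover R Γ)
    (hn : NoConflict φ Γ) {a b : Γ.V} {x : A} (hij : i ≠ j) (ha : Γ.Inc i a)
    (h : Act φ Γ i a (φ i x) b) (hj : Γ.Inc j a ∨ Γ.Inc j b) :
    Γ.Inc j a ∧ Act φ Γ j a (φ j x) b := by
  rcases hj with hj | hj
  · obtain ⟨c, hc⟩ := hΓ.total hφ hj (φ j x)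
    obtain rfl := hn a (LGraph.mem_VB_of_ne hij ha hj) i j x b c hij h hc
    exact ⟨hj, hc⟩
  · obtain ⟨c, hc⟩ := hΓ.total hφ hj (φ j x)⁻¹
    have h' := h.symm
    rw [← map_inv] at h'
    rw [← map_inv] at hc
    obtain rfl := hn b (LGraph.mem_VB_of_ne hij (h.inc ha) hj) i j x⁻¹ a c hij h' hc
    refine ⟨hc.inc hj, ?_⟩
    simpa using hc.symm

variable (φ) in
/-- Paths that are divided into monochromatic pieces with at least one edge at their initial
vertex; the list contains the elements of the factors that the pieces represent. -/
inductive SylPath (Γ : LGraph X) : Γ.V → List (Σ i, PresentedGroup (R i)) → Γ.V → Prop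
  | nil (a : Γ.V) : SylPath Γ a [] a
  | cons {a b c : Γ.V} {s : Σ i, PresentedGroup (R i)} {l : List (Σ i, PresentedGroup (R i))}
      (ha : Γ.Inc s.1 a) (h : Act φ Γ s.1 a s.2 b) (hl : SylPath Γ b l c) :
      SylPath Γ a (s :: l) c

variable (φ) in
/-- The element of the amalgam represented by a list of elements of the factors. -/
def sylVal (l : List (Σ i, PresentedGroup (R i))) : PushoutI φ :=
  (l.map fun s => PushoutI.of (φ := φ) s.1 s.2).prod

theorem SylPath.exists_of_path {a b : Γ.V} {w : List (Letter X)} (h : Γ.HasPath a w b) :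
    ∃ l, SylPath φ Γ a l b ∧ sylVal φ l = val φ w := by
  induction h with
  | nil a => exact ⟨[], .nil a, by simp [sylVal]⟩
  | cons e h ih =>
    obtain ⟨l, hl, hv⟩ := ih
    obtain ⟨x, hx⟩ := Letter.exists_eq (i := Γ.color e) (l := Γ.lab e) rfl
    refine ⟨⟨Γ.color e, genVal R x⟩ :: l, .cons ⟨e, rfl, rfl⟩ (.edge e hx) hl, ?_⟩
    rw [val_cons, hx, val_letter, ← hv]
    simp [sylVal]

/-- Pieces of one colour are multiplied. For different colours the piece in `A` is recoloured; the
common vertex of the two pieces carries both colours, so `Cover.convert` applies. -/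
theorem SylPath.merge_head (hφ : ∀ i, Function.Injective (φ i)) (hΓ : Cover R Γ)
    (hn : NoConflict φ Γ) {a b : Γ.V} {s t : Σ i, PresentedGroup (R i)}
    {l : List (Σ i, PresentedGroup (R i))} (h : SylPath φ Γ a (s :: t :: l) b)
    (hst : s.1 = t.1 ∨ s.2 ∈ (φ s.1).range ∨ t.2 ∈ (φ t.1).range) :
    ∃ r, SylPath φ Γ a (r :: l) b ∧ sylVal φ (r :: l) = sylVal φ (s :: t :: l) := by
  obtain ⟨i, g⟩ := s
  obtain ⟨j, k⟩ := t
  cases h with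
  | cons ha h hl =>
  cases hl with
  | cons hb h' hl =>
  simp only at ha h hb h' hst
  rcases eq_or_ne i j with rfl | hij
  · exact ⟨⟨i, g * k⟩, .cons ha (h.trans h') hl, by simp [sylVal, mul_assoc]⟩
  · rcases hst with hst | ⟨x, hx⟩ | ⟨x, hx⟩
    · exact absurd hst hij
    · obtain rfl : φ i x = g := hx
      obtain ⟨ha', h⟩ := hΓ.convert hφ hn hij ha h (.inr hb)
      refine ⟨⟨j, φ j x * k⟩, .cons ha' (h.trans h') hl, ?_⟩
      simp [sylVal, mul_assoc, PushoutI.of_apply_eq_base]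
    · obtain rfl : φ j x = k := hx
      obtain ⟨-, h'⟩ := hΓ.convert hφ hn hij.symm hb h' (.inl (h.inc ha))
      refine ⟨⟨i, g * φ i x⟩, .cons ha (h.trans h') hl, ?_⟩
      simp [sylVal, mul_assoc, PushoutI.of_apply_eq_base]

theorem SylPath.merge (hφ : ∀ i, Function.Injective (φ i)) (hΓ : Cover R Γ)
    (hn : NoConflict φ Γ) {s t : Σ i, PresentedGroup (R i)}
    (hst : s.1 = t.1 ∨ s.2 ∈ (φ s.1).range ∨ t.2 ∈ (φ t.1).range)
    {l' l : List (Σ i, PresentedGroup (R i))} {a b : Γ.V}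
    (h : SylPath φ Γ a (l' ++ s :: t :: l) b) :
    ∃ r, SylPath φ Γ a (l' ++ r :: l) b ∧
      sylVal φ (l' ++ r :: l) = sylVal φ (l' ++ s :: t :: l) := by
  induction l' generalizing a with
  | nil => exact h.merge_head hφ hΓ hn hst
  | cons q l' ih =>
    cases h with
    | cons ha h hl =>
    obtain ⟨r, hr, hv⟩ := ih hl
    refine ⟨r, .cons ha h hr, ?_⟩
    simp only [sylVal, List.cons_append, List.map_cons, List.prod_cons] at hv ⊢
    rw [hv]

/-- A list of at least two elements of the factors which cannot be shortened does not
represent `1`. -/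
theorem sylVal_ne_one (hφ : ∀ i, Function.Injective (φ i))
    {s t : Σ i, PresentedGroup (R i)} {l : List (Σ i, PresentedGroup (R i))}
    (h : ∀ s' t' l₁ l₂, s :: t :: l = l₁ ++ s' :: t' :: l₂ →
      s'.1 ≠ t'.1 ∧ s'.2 ∉ (φ s'.1).range ∧ t'.2 ∉ (φ t'.1).range) :
    sylVal φ (s :: t :: l) ≠ 1 := by
  have hr : ∀ r ∈ s :: t :: l, r.2 ∉ (φ r.1).range := by
    intro r hr
    obtain ⟨l₁, l₂, hl⟩ := List.append_of_mem hr
    cases l₂ with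
    | cons q l₂ => exact (h r q l₁ l₂ hl).2.1
    | nil =>
      -- The last element has no successor, so the hypothesis is used for the pair formed with its
      -- predecessor, which exists since the list has length at least two.
      rcases List.eq_nil_or_concat l₁ with rfl | ⟨l₁, q, rfl⟩
      · simp at hl
      · exact (h q r l₁ [] (by simpa using hl)).2.2
  let w : Monoid.CoprodI.Word fun i => PresentedGroup (R i) :=
    { toList := s :: t :: l
      ne_one := fun r hm h1 => hr r hm (h1 ▸ one_mem _)
      chain_ne := List.isChain_iff_forall_rel_of_append_cons_cons.2
        fun _ _ _ _ hl => (h _ _ _ _ hl).1 }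
  intro hv
  have hw : (PushoutI.ofCoprodI w.prod : PushoutI φ) = sylVal φ (s :: t :: l) := by
    rw [Monoid.CoprodI.Word.prod, map_list_prod, sylVal, List.map_map]
    exact congrArg _ (List.map_congr_left fun r _ => PushoutI.ofCoprodI_of _ _)
  -- The normal form theorem: a reduced word with value in `A`, here the value `1`, is empty.
  have := PushoutI.Reduced.eq_empty_of_mem_range hφ (w := w) hr (by
    rw [hw, hv]; exact one_mem _)
  simpa [w, Monoid.CoprodI.Word.empty] using congrArg Monoid.CoprodI.Word.toList this

/-- Induction on the number of pieces: merging shortens the list, and a list that admits no merging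
and represents `1` has at most one piece by `sylVal_ne_one`. -/
theorem SylPath.eq_of_sylVal_eq_one (hφ : ∀ i, Function.Injective (φ i)) (hΓ : Cover R Γ)
    (hn : NoConflict φ Γ) {a b : Γ.V} {l : List (Σ i, PresentedGroup (R i))}
    (h : SylPath φ Γ a l b) (hv : sylVal φ l = 1) : a = b := by
  induction hk : l.length using Nat.strong_induction_on generalizing l with
  | _ k ih =>
    by_cases hs : ∃ s t l₁ l₂, l = l₁ ++ s :: t :: l₂ ∧
        (s.1 = t.1 ∨ s.2 ∈ (φ s.1).range ∨ t.2 ∈ (φ t.1).range)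
    · obtain ⟨s, t, l₁, l₂, rfl, hst⟩ := hs
      obtain ⟨r, hr, hv'⟩ := h.merge hφ hΓ hn hst
      refine ih _ ?_ hr (hv'.trans hv) rfl
      rw [← hk]
      simp
    · push Not at hs
      match l with
      | [] => cases h; rfl
      | [s] =>
        cases h with
        | cons ha h hl =>
        cases hl
        have h1 : s.2 = 1 := PushoutI.of_injective hφ s.1 (by simpa [sylVal] using hv)
        rw [h1] at h
        exact hΓ.eq_of_act_one hφ h
      | s :: t :: l => exact absurd hv (sylVal_ne_one hφ hs)

theorem Cover.gBased (hφ : ∀ i, Function.Injective (φ i)) (hΓ : Cover R Γ)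
    (hn : NoConflict φ Γ) : GBased φ Γ := by
  intro a b w hw hv
  obtain ⟨l, hl, hlv⟩ := SylPath.exists_of_path (φ := φ) hw
  exact hl.eq_of_sylVal_eq_one hφ hΓ hn (hlv.trans hv)

end Covers

/-! ### Relative Cayley graphs as quotients of the Cayley graph. -/

section RelativeCayley

variable {X : Fin 2 → Type u} {R : ∀ i, Set (FreeGroup (X i))} {i : Fin 2}

theorem coset_eq_iff {S : Subgroup (PresentedGroup (R i))} {g h : PresentedGroup (R i)} :
    coset S g = coset S h ↔ h * g⁻¹ ∈ S := by
  rw [← QuotientGroup.rightRel_apply]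
  exact Quotient.eq

theorem coset_surjective (S : Subgroup (PresentedGroup (R i))) :
    Function.Surjective (coset S) := Quotient.mk_surjective

theorem isOrbitMap_coset (S : Subgroup (PresentedGroup (R i))) :
    IsOrbitMap R (relCayley S) i (coset S) := fun g x =>
  ⟨(coset S g, x), rfl, rfl, rfl⟩

theorem isOrbitMap_cayley (i : Fin 2) : IsOrbitMap R (cayley R i) i fun g => g := fun g x =>
  ⟨(g, x), rfl, rfl, rfl⟩

theorem relCayley_wellLabelled (S : Subgroup (PresentedGroup (R i))) :
    (relCayley S).WellLabelled := by
  rintro ⟨c, x⟩ ⟨d, y⟩ h h'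
  obtain rfl : c = d := h
  obtain rfl : x = y := letter_injective i h'
  rfl

theorem coset_bot_injective : Function.Injective (coset (⊥ : Subgroup (PresentedGroup (R i)))) := by
  intro g h hgh
  rw [coset_eq_iff, Subgroup.mem_bot, mul_inv_eq_one] at hgh
  exact hgh.symm

/-- The Cayley graph is the relative Cayley graph of the trivial subgroup. -/
noncomputable def cayleyIso (i : Fin 2) : (cayley R i).Iso (relCayley (R := R) (i := i) ⊥) where
  onV := Equiv.ofBijective (coset ⊥) ⟨coset_bot_injective, coset_surjective _⟩
  onE := Equiv.ofBijective (fun p => (coset ⊥ p.1, p.2)) ⟨by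
    rintro ⟨g, x⟩ ⟨h, y⟩ hgh
    obtain rfl : g = h := coset_bot_injective (congrArg Prod.fst hgh)
    obtain rfl : x = y := congrArg Prod.snd hgh
    rfl, by
    rintro ⟨c, x⟩
    obtain ⟨g, rfl⟩ := coset_surjective _ c
    exact ⟨(g, x), rfl⟩⟩
  ini_onE _ := rfl
  rev_onE _ := rfl
  lab_onE _ := rfl

end RelativeCayley

/-! ### Well-labelled precovers; redundancy in terms of stabilizers. -/

section Good

variable {X : Fin 2 → Type u} {R : ∀ i, Set (FreeGroup (X i))} {A : Type v} [Group A]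
  {φ : ∀ i, A →* PresentedGroup (R i)} {Γ Δ : LGraph X} {i j : Fin 2}

open Monoid (PushoutI)

theorem Act.lift_comp {e : Γ.E} {a b : Γ.V} {g : PresentedGroup (R (Γ.color e))}
    (h : Act φ Γ (Γ.color e) a g b) (ha : a ∈ Γ.compV e) (hb : b ∈ Γ.compV e) :
    Act φ (Γ.comp e) (Γ.color e) ⟨a, ha⟩ g ⟨b, hb⟩ := by
  obtain ⟨w, hw, hv⟩ := h
  exact ⟨w, ⟨hw.lift_comp ha hb, hw.2⟩, hv⟩

theorem comp_wellLabelled (hΓ : Γ.WellLabelled) (e : Γ.E) : (Γ.comp e).WellLabelled :=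
  fun _ _ h h' => Subtype.ext (hΓ _ _ (congrArg Subtype.val h) h')

/-- An isomorphism of pointed graphs preserves stabilizers, and the stabilizer of the coset `S · 1`
is `S`. Hence the subgroup in the tests of steps 5 and 6 is determined by the vertex. -/
theorem CompIso.eq_stab (hφ : ∀ i, Function.Injective (φ i)) {e : Γ.E} {t : Γ.V}
    {S : Subgroup (PresentedGroup (R (Γ.color e)))} (h : CompIso Γ e t S) :
    t ∈ Γ.compV e ∧ S = stab φ Γ (Γ.color e) t := by
  obtain ⟨f, ht, hf⟩ := h
  refine ⟨ht, ?_⟩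
  ext g
  have key : g ∈ S ↔ Act φ (relCayley S) (Γ.color e) (coset S 1) g (coset S 1) := by
    rw [(isOrbitMap_coset S).act_iff hφ (relCayley_wellLabelled S), coset_eq_iff]
    simp
  rw [key, mem_stab]
  constructor
  · intro h
    have h' := (h.map f.symm.toHom).map (Γ.compHom e)
    have hs : f.symm.toHom.onV (coset S 1) = ⟨t, ht⟩ := by
      rw [← hf]
      exact f.onV.symm_apply_apply _
    rw [hs] at h'
    exact h'
  · intro h
    have h' := (h.lift_comp ht ht).map f.toHom
    rwa [show f.toHom.onV ⟨t, ht⟩ = _ from hf] at h'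

/-- The orbit map at `t` identifies two elements exactly when they lie in the same right coset of
the stabilizer, and its image is the whole component. It therefore descends to an isomorphism. -/
theorem Cover.compIso (hφ : ∀ i, Function.Injective (φ i)) (hΓ : Cover R Γ) {e : Γ.E} {t : Γ.V}
    (ht : t ∈ Γ.compV e) : CompIso Γ e t (stab φ Γ (Γ.color e) t) := by
  obtain ⟨m, hm, hm1⟩ := hΓ.covAt _ _ (LGraph.compV_inc ht)
  set S := stab φ Γ (Γ.color e) t with hS
  have hmem : ∀ g, m g ∈ Γ.compV e := fun g => by
    have h := hm.act hφ 1 g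
    rw [one_mul, hm1] at h
    exact h.mem_compV ht
  have hmm : ∀ g h, m g = m h ↔ h * g⁻¹ ∈ S := fun g h => by
    rw [hS, ← hm1, ← hm.eq_iff hφ hΓ.wl, eq_comm]
  let F : (relCayley S).V → (Γ.comp e).V :=
    Quotient.lift (fun g => ⟨m g, hmem g⟩) fun g h hgh =>
      Subtype.ext ((hmm g h).2 (QuotientGroup.rightRel_apply.1 hgh))
  have hF : ∀ g, F (coset S g) = ⟨m g, hmem g⟩ := fun _ => rfl
  have hE : ∀ p : (relCayley S).E, ∃ f : (Γ.comp e).E,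
      (Γ.comp e).ini f = F ((relCayley S).ini p) ∧
      (Γ.comp e).lab f = (relCayley S).lab p ∧
      (Γ.comp e).ter f = F ((relCayley S).ter p) := by
    rintro ⟨c, x⟩
    obtain ⟨g, rfl⟩ := coset_surjective S c
    obtain ⟨f, h1, h2, h3⟩ := hm g x
    exact ⟨⟨f, by rw [LGraph.color, h2]; rfl, h1 ▸ hmem g⟩, Subtype.ext h1, h2, Subtype.ext h3⟩
  choose FE h1 h2 h3 using hE
  have hwl := comp_wellLabelled hΓ.wl e
  have hFi : Function.Injective F := by
    intro c d hcd
    obtain ⟨g, rfl⟩ := coset_surjective S c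
    obtain ⟨h, rfl⟩ := coset_surjective S d
    exact coset_eq_iff.2 ((hmm g h).1 (congrArg Subtype.val hcd))
  have hFs : Function.Surjective F := by
    rintro ⟨a, ha⟩
    obtain ⟨g, hg⟩ := exists_act_of_mem_compV (φ := φ) ht ha
    rw [← hm1, hm.act_iff hφ hΓ.wl, one_mul] at hg
    exact ⟨coset S g, Subtype.ext hg.symm⟩
  have hEi : Function.Injective FE := fun p q hpq =>
    relCayley_wellLabelled S p q (hFi (by rw [← h1, ← h1, hpq])) (by rw [← h2, ← h2, hpq])
  have hEs : Function.Surjective FE := by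
    intro f
    obtain ⟨c, hc⟩ := hFs ((Γ.comp e).ini f)
    obtain ⟨x, hx⟩ := Letter.exists_eq (l := (Γ.comp e).lab f) f.2.1
    exact ⟨(c, x), hwl _ _ ((h1 _).trans hc) ((h2 _).trans hx.symm)⟩
  let f : (relCayley S).Iso (Γ.comp e) :=
    { onV := Equiv.ofBijective F ⟨hFi, hFs⟩
      onE := Equiv.ofBijective FE ⟨hEi, hEs⟩
      ini_onE := h1
      -- An edge of a well-labelled graph is determined by its initial vertex and label, so
      -- compatibility with reversal need not be built into the choice of `FE`.
      rev_onE := fun p => hwl _ _ ((h3 p).trans (h1 _).symm) (by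
        rw [LGraph.lab_rev]
        exact (congrArg Letter.inv (h2 p)).trans
          (((relCayley S).lab_rev p).symm.trans (h2 _).symm))
      lab_onE := h2 }
  refine ⟨f.symm, ht, ?_⟩
  have : (⟨t, ht⟩ : (Γ.comp e).V) = f.onV (coset S 1) := Subtype.ext hm1.symm
  rw [this]
  exact f.onV.symm_apply_apply _

variable (φ) in
/-- A well-labelled precover, with the covering condition in terms of morphisms from
Cayley graphs. -/
structure Good (Γ : LGraph X) : Prop where
  cover : Cover R Γ
  gBased : GBased φ Γ
  connected : Γ.Connected

theorem Good.isPrecover (hφ : ∀ i, Function.Injective (φ i)) (hΓ : Good φ Γ) :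
    IsPrecover φ Γ :=
  ⟨hΓ.connected, hΓ.gBased, fun e => by
    obtain ⟨f, -⟩ := hΓ.cover.compIso hφ (Γ.ini_mem_compV e)
    exact ⟨_, ⟨f⟩⟩⟩

/-- One path reversed and followed by the other has trivial label, so being `G`-based closes it.
This recovers the agreement of the two actions of `A` at every vertex. -/
theorem Good.compat (hΓ : Good φ Γ) {x : A} {a b c : Γ.V} (h : Act φ Γ i a (φ i x) b)
    (h' : Act φ Γ j a (φ j x) c) : b = c := by
  obtain ⟨w, hw, hv⟩ := h
  obtain ⟨w', hw', hv'⟩ := h'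
  refine hΓ.gBased b c _ (hw.reverse.1.append hw'.1) ?_
  rw [val_append, val_reverse, hv, hv', PushoutI.of_apply_eq_base, PushoutI.of_apply_eq_base,
    inv_mul_cancel]

theorem Good.convert (hφ : ∀ i, Function.Injective (φ i)) (hΓ : Good φ Γ) {a b : Γ.V} {x : A}
    (j : Fin 2) (ha : Γ.Inc j a) (h : Act φ Γ i a (φ i x) b) : Act φ Γ j a (φ j x) b := by
  obtain ⟨c, hc⟩ := hΓ.cover.total hφ ha (φ j x)
  rwa [hΓ.compat h hc]

theorem Good.mem_VB_of_act (hφ : ∀ i, Function.Injective (φ i)) (hΓ : Good φ Γ) {a b : Γ.V}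
    {x : A} (ha : a ∈ Γ.VB) (h : Act φ Γ i a (φ i x) b) : b ∈ Γ.VB :=
  fun j => (hΓ.convert hφ j (ha j) h).inc (ha j)

/-- Orbit and stabilizer: the vertices of the `A`-orbit correspond to the cosets in `A` of its
intersection with the stabilizer. This translates the count in the removal test. -/
theorem Cover.ncard_orbit (hφ : ∀ i, Function.Injective (φ i)) (hΓ : Cover R Γ) {t : Γ.V}
    (ht : Γ.Inc i t) : (orbit φ Γ i t).ncard = (stab φ Γ i t).relIndex (φ i).range := by
  obtain ⟨m, hm, hm1⟩ := hΓ.covAt _ _ ht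
  -- Vertices are right cosets, while the index counts left cosets; inversion passes from one to the
  -- other.
  have key : ∀ g h : (φ i).range, m (g : PresentedGroup (R i))⁻¹ = m (h : PresentedGroup (R i))⁻¹ ↔
      g⁻¹ * h ∈ (stab φ Γ i t).subgroupOf (φ i).range := fun g h => by
    rw [hm.eq_iff hφ hΓ.wl, inv_inv, hm1]
    rfl
  let F : (φ i).range ⧸ (stab φ Γ i t).subgroupOf (φ i).range → Γ.V :=
    Quotient.lift (fun g => m (g : PresentedGroup (R i))⁻¹) fun g h hgh =>
      (key g h).2 (QuotientGroup.leftRel_apply.1 hgh)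
  have hF : Function.Injective F := by
    intro p q hpq
    induction p using QuotientGroup.induction_on with | _ g
    induction q using QuotientGroup.induction_on with | _ h
    exact QuotientGroup.eq.2 ((key g h).1 hpq)
  have hr : orbit φ Γ i t = Set.range F := by
    ext b
    rw [mem_orbit hφ]
    have : ∀ x, Act φ Γ i t (φ i x) b ↔ b = m (φ i x) := fun x => by
      rw [← hm1, hm.act_iff hφ hΓ.wl, one_mul]
    simp_rw [this]
    constructor
    · rintro ⟨x, rfl⟩
      refine ⟨QuotientGroup.mk ⟨φ i x⁻¹, x⁻¹, rfl⟩, ?_⟩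
      change m (φ i x⁻¹)⁻¹ = _
      rw [map_inv, inv_inv]
    · rintro ⟨p, rfl⟩
      induction p using QuotientGroup.induction_on with | _ g
      obtain ⟨_, x, rfl⟩ := g
      refine ⟨x⁻¹, ?_⟩
      change m (φ i x)⁻¹ = _
      rw [map_inv]
  rw [hr, ← Nat.card_coe_set_eq, Nat.card_range_of_injective hF]
  rfl

theorem Good.orbit_subset (hφ : ∀ i, Function.Injective (φ i)) (hΓ : Good φ Γ) {e : Γ.E}
    {t : Γ.V} (ht : t ∈ Γ.compVB e) : orbit φ Γ (Γ.color e) t ⊆ Γ.compVB e := by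
  intro b hb
  obtain ⟨x, hx⟩ := (mem_orbit hφ).1 hb
  exact ⟨hx.mem_compV ht.1, hΓ.mem_VB_of_act hφ ht.2 hx⟩

/-- Together with the translation of `monoLab` into stabilizers, this shows that the second kind of
redundancy is detected by the test of step 5. -/
theorem Good.removable (hφ : ∀ i, Function.Injective (φ i)) {Γ : PGraph X}
    (hΓ : Good φ Γ.toLGraph) {e : Γ.E} {t : Γ.V} (ht : t ∈ Γ.compVB e)
    (hs : stab φ Γ.toLGraph (Γ.color e) t ≤ (φ (Γ.color e)).range)
    (ho : Γ.compVB e ⊆ orbit φ Γ.toLGraph (Γ.color e) t)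
    (hb : Γ.base ∉ Γ.compV e ∨
      (Γ.base ∈ Γ.compVB e ∧ stab φ Γ.toLGraph (Γ.color e) t = ⊥)) : Removable φ Γ e := by
  refine ⟨t, ht, _, hs, hΓ.cover.compIso hφ ht.1, ?_, ?_⟩
  · rw [← hΓ.cover.ncard_orbit hφ (LGraph.compV_inc ht.1), ho.antisymm (hΓ.orbit_subset hφ ht)]
  · rcases hb with hb | ⟨hb, hs⟩
    · by_cases hs : stab φ Γ.toLGraph (Γ.color e) t = ⊥
      · exact .inl ⟨hs, fun h => hb h.1⟩
      · exact .inr ⟨hs, hb⟩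
    · refine .inl ⟨hs, fun h => ?_⟩
      -- In `Fin 2` the other colour is `1 - i`.
      obtain ⟨f, hf, hc⟩ := hb.2 (1 - Γ.color e)
      have := hc.symm.trans (h.2 f hf)
      omega

/-- The orbit of `t` consists of bichromatic vertices of the component, and the test says that it
has as many elements as there are such vertices; finiteness makes the two sets equal. -/
theorem Good.of_removable (hφ : ∀ i, Function.Injective (φ i)) {Γ : PGraph X} [Finite Γ.V]
    (hΓ : Good φ Γ.toLGraph) {e : Γ.E} (h : Removable φ Γ e) :
    ∃ t ∈ Γ.compVB e, stab φ Γ.toLGraph (Γ.color e) t ≤ (φ (Γ.color e)).range ∧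
      Γ.compVB e = orbit φ Γ.toLGraph (Γ.color e) t := by
  obtain ⟨t, ht, K, hK, hi, hn, -⟩ := h
  obtain ⟨-, rfl⟩ := hi.eq_stab hφ
  refine ⟨t, ht, hK, ?_⟩
  rw [← hΓ.cover.ncard_orbit hφ (LGraph.compV_inc ht.1)] at hn
  exact (Set.eq_of_subset_of_ncard_le (hΓ.orbit_subset hφ ht) hn.le (Set.toFinite _)).symm

/-- In a removable component, paths between bichromatic vertices represent elements of the
amalgamated subgroup. -/
theorem Good.mem_range_of_removable (hφ : ∀ i, Function.Injective (φ i)) {Γ : PGraph X}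
    [Finite Γ.V] (hΓ : Good φ Γ.toLGraph) {e : Γ.E} (h : Removable φ Γ e) {a b : Γ.V}
    (ha : a ∈ Γ.compVB e) (hb : b ∈ Γ.compVB e) {g : PresentedGroup (R (Γ.color e))}
    (hg : Act φ Γ.toLGraph (Γ.color e) a g b) : g ∈ (φ (Γ.color e)).range := by
  obtain ⟨t, ht, hs, ho⟩ := hΓ.of_removable hφ h
  rw [ho, mem_orbit hφ] at ha hb
  obtain ⟨x, hx⟩ := ha
  obtain ⟨y, hy⟩ := hb
  have := hs ((hx.trans hg).trans hy.symm)
  obtain ⟨z, hz⟩ := this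
  refine ⟨x⁻¹ * z * y, ?_⟩
  rw [map_mul, map_mul, hz, map_inv]
  group

/-- At a bichromatic vertex an element of `A` that closes a path in one colour closes one in the
other. -/
theorem Good.base_cond (hφ : ∀ i, Function.Injective (φ i)) {Γ : PGraph X}
    (hΓ : Good φ Γ.toLGraph) (hb : Γ.base ∈ Γ.VB) (e : Γ.E) :
    ∃ f : Γ.E, Γ.color f ≠ Γ.color e ∧ Γ.base ∈ Γ.compV f ∧
      monoLab φ Γ.toLGraph (Γ.color e) Γ.base ∩ amal φ =
        monoLab φ Γ.toLGraph (Γ.color f) Γ.base ∩ amal φ := by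
  have key : ∀ i j, monoLab φ Γ.toLGraph i Γ.base ∩ amal φ ⊆
      monoLab φ Γ.toLGraph j Γ.base ∩ amal φ := by
    rintro i j z ⟨hz, hz'⟩
    refine ⟨?_, hz'⟩
    obtain ⟨g, hg, rfl⟩ := mem_monoLab.1 hz
    obtain ⟨x, rfl⟩ := (of_mem_amal_iff hφ).1 hz'
    refine mem_monoLab.2 ⟨φ j x, hΓ.convert hφ j (hb j) hg, ?_⟩
    rw [PushoutI.of_apply_eq_base, PushoutI.of_apply_eq_base]
  obtain ⟨f, hf, hc⟩ := hb (1 - Γ.color e)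
  exact ⟨f, by omega, hf ▸ Γ.ini_mem_compV f, (key _ _).antisymm (key _ _)⟩

end Good

/-! ### Preservation of the subgroup: potentials and rerouting of paths. -/

section Sound

variable {X : Fin 2 → Type u} {R : ∀ i, Set (FreeGroup (X i))} {A : Type v} [Group A]
  (φ : ∀ i, A →* PresentedGroup (R i)) (ws : List (List (Letter X)))

open Monoid (PushoutI)

/-- The subgroup generated by the elements that the given words represent. -/
def inputSubgroup : Subgroup (PushoutI φ) := Subgroup.closure {g | ∃ w ∈ ws, val φ w = g}

/-- The map `p` is a morphism to the coset graph of the subgroup generated by the given words. -/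
def IsPotential (Γ : LGraph X) (p : Γ.V → PushoutI φ ⧸ inputSubgroup φ ws) : Prop :=
  ∀ e, p (Γ.ini e) = val φ [Γ.lab e] • p (Γ.ter e)

/-- A finite connected graph in which the paths closed at the basepoint represent the elements
of the subgroup generated by the given words. -/
structure Sound (Γ : PGraph X) : Prop where
  finite_V : Finite Γ.V
  finite_E : Finite Γ.E
  connected : Γ.Connected
  val_mem : ∀ w ∈ ws, val φ w ∈ Lab φ Γ
  potential : ∃ p, IsPotential φ ws Γ.toLGraph p ∧ p Γ.base = QuotientGroup.mk 1

variable {φ ws} {Γ Δ : PGraph X}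

theorem IsPotential.eq_smul {Γ : LGraph X} {p : Γ.V → PushoutI φ ⧸ inputSubgroup φ ws}
    (hp : IsPotential φ ws Γ p) {a b : Γ.V} {w : List (Letter X)} (h : Γ.HasPath a w b) :
    p a = val φ w • p b := by
  induction h with
  | nil a => rw [val_nil, one_smul]
  | cons e _ ih => rw [hp e, ih, smul_smul, ← val_cons]

theorem IsPotential.act {Γ : LGraph X} {p : Γ.V → PushoutI φ ⧸ inputSubgroup φ ws}
    (hp : IsPotential φ ws Γ p) {i : Fin 2} {a b : Γ.V} {g : PresentedGroup (R i)}
    (h : Act φ Γ i a g b) : p a = PushoutI.of (φ := φ) i g • p b := by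
  obtain ⟨w, hw, hv⟩ := h
  rw [hp.eq_smul hw.1, hv]

theorem Lab.mul_mem {x y : PushoutI φ} (hx : x ∈ Lab φ Γ) (hy : y ∈ Lab φ Γ) :
    x * y ∈ Lab φ Γ := by
  obtain ⟨w, hw, rfl⟩ := hx
  obtain ⟨w', hw', rfl⟩ := hy
  exact ⟨_, hw.append hw', val_append ..⟩

theorem Lab.inv_mem {x : PushoutI φ} (hx : x ∈ Lab φ Γ) : x⁻¹ ∈ Lab φ Γ := by
  obtain ⟨w, hw, rfl⟩ := hx
  exact ⟨_, hw.reverse, val_reverse ..⟩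

/-- Along a closed path at the basepoint the potential shows that the value fixes the coset `H`,
hence lies in `H`. Conversely the values of closed paths form a subgroup containing the generators.
-/
theorem Sound.lab_eq (h : Sound φ ws Γ) : Lab φ Γ = inputSubgroup φ ws := by
  apply Set.Subset.antisymm
  · rintro _ ⟨w, hw, rfl⟩
    obtain ⟨p, hp, hb⟩ := h.potential
    have := hp.eq_smul hw
    rw [hb, MulAction.Quotient.smul_mk, QuotientGroup.eq] at this
    simpa using this
  · let L : Subgroup (PushoutI φ) :=
      { carrier := Lab φ Γ
        mul_mem' := Lab.mul_mem
        one_mem' := ⟨[], .nil _, val_nil φ⟩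
        inv_mem' := Lab.inv_mem }
    exact (Subgroup.closure_le L).2 fun _ ⟨w, hw, hg⟩ => hg ▸ h.val_mem w hw

theorem Lab.map (f : Γ.Hom Δ.toLGraph) (hb : f.onV Γ.base = Δ.base) : Lab φ Γ ⊆ Lab φ Δ := by
  rintro _ ⟨w, hw, rfl⟩
  have := hw.map f
  rw [hb] at this
  exact ⟨w, this, rfl⟩

/-- Soundness passes to subgraphs in which every path of the whole graph can be replaced. -/
theorem Sound.of_subgraph (h : Sound φ ws Γ) (f : Δ.Hom Γ.toLGraph)
    (hV : Function.Injective f.onV) (hE : Function.Injective f.onE) (hb : f.onV Δ.base = Γ.base)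
    (hp : ∀ a b w, Γ.HasPath (f.onV a) w (f.onV b) → ∃ w', Δ.HasPath a w' b ∧ val φ w' = val φ w) :
    Sound φ ws Δ where
  finite_V := have := h.finite_V; .of_injective _ hV
  finite_E := have := h.finite_E; .of_injective _ hE
  connected := ⟨⟨Δ.base⟩, fun a b => by
    obtain ⟨w, hw⟩ := h.connected.2 (f.onV a) (f.onV b)
    obtain ⟨w', hw', -⟩ := hp a b w hw
    exact ⟨w', hw'⟩⟩
  val_mem w hw := by
    obtain ⟨w', hw', hv⟩ := h.val_mem w hw
    rw [← hb] at hw'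
    obtain ⟨w'', hw'', hv'⟩ := hp _ _ _ hw'
    exact ⟨w'', hw'', hv'.trans hv⟩
  potential := by
    obtain ⟨p, hp, hp1⟩ := h.potential
    refine ⟨p ∘ f.onV, fun e => ?_, by rw [Function.comp_apply, hb, hp1]⟩
    have := hp (f.onE e)
    rwa [f.ini_onE, f.ter_onE, f.lab_onE] at this

theorem Sound.fold (h : Sound φ ws Γ) {e f : Γ.E} (hef : Γ.Foldable e f) :
    Sound φ ws (Γ.fold e f hef) where
  finite_V := have := h.finite_V; inferInstanceAs (Finite (Quot _))
  finite_E := have := h.finite_E; inferInstanceAs (Finite (Quot _))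
  connected := h.connected.of_surjective (Γ.identEdgesHom e f hef.lab_eq) Quot.mk_surjective
  val_mem w hw := Lab.map (Γ.identEdgesHom e f hef.lab_eq) rfl (h.val_mem w hw)
  potential := by
    obtain ⟨p, hp, hp1⟩ := h.potential
    refine ⟨Quot.lift p ?_, Quot.ind hp, hp1⟩
    rintro a b (⟨rfl, rfl⟩ | ⟨rfl, rfl⟩)
    · rw [hef.ini_eq]
    · have := hp e
      rw [hef.ini_eq, hp f, hef.lab_eq] at this
      exact (MulAction.injective _ this).symm

theorem Sound.identify (h : Sound φ ws Γ) {c a b : Γ.V} (hc : Conflict φ Γ.toLGraph c a b) :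
    Sound φ ws (Γ.identify a b) where
  finite_V := have := h.finite_V; inferInstanceAs (Finite (Quot _))
  finite_E := h.finite_E
  connected := h.connected.of_surjective (Γ.identVertsHom _) Quot.mk_surjective
  val_mem w hw := Lab.map (Γ.identVertsHom _) rfl (h.val_mem w hw)
  potential := by
    obtain ⟨p, hp, hp1⟩ := h.potential
    refine ⟨Quot.lift p ?_, hp, hp1⟩
    rintro _ _ ⟨rfl, rfl⟩
    obtain ⟨-, w, w', hw, hw', -, -, hv⟩ := hc
    have := hp.eq_smul hw.1
    rw [hp.eq_smul hw'.1, hv] at this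
    exact (MulAction.injective _ this).symm

/-- The signed generator that labels the edge `e`. -/
def LGraph.gen (Γ : LGraph X) (e : Γ.E) : X (Γ.color e) × Bool := ((Γ.lab e).1.2, (Γ.lab e).2)

variable (R Γ) in
/-- The morphism from the original graph to the graph with a Cayley graph glued on. -/
def glueCayleyInl (e : Γ.E) : Γ.Hom (glueCayley R Γ e).toLGraph :=
  ((Γ.disjUnion (cayley R (Γ.color e))).identEdgesHom (Sum.inl e)
    (Sum.inr ((1 : PresentedGroup (R (Γ.color e))), Γ.gen e)) rfl).comp
    (Γ.inlHom (cayley R (Γ.color e)))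

variable (R Γ) in
/-- The morphism from the Cayley graph that is glued on. -/
def glueCayleyInr (e : Γ.E) : (cayley R (Γ.color e)).Hom (glueCayley R Γ e).toLGraph :=
  ((Γ.disjUnion (cayley R (Γ.color e))).identEdgesHom (Sum.inl e)
    (Sum.inr ((1 : PresentedGroup (R (Γ.color e))), Γ.gen e)) rfl).comp
    (Γ.inrHom (cayley R (Γ.color e)))

theorem glueCayleyInr_one (e : Γ.E) :
    (glueCayleyInr R Γ e).onV (1 : PresentedGroup (R (Γ.color e))) =
      (glueCayleyInl R Γ e).onV (Γ.ini e) :=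
  (Quot.sound (r := (Γ.disjUnion (cayley R (Γ.color e))).EdgeRelV (Sum.inl e)
    (Sum.inr ((1 : PresentedGroup (R (Γ.color e))), Γ.gen e))) (Or.inl ⟨rfl, rfl⟩)).symm

theorem covAt_glueCayleyInr (e : Γ.E) (g : PresentedGroup (R (Γ.color e))) :
    CovAt R (glueCayley R Γ e).toLGraph (Γ.color e) ((glueCayleyInr R Γ e).onV g) :=
  ((isOrbitMap_cayley _).covAt g).map (glueCayleyInr R Γ e)

theorem Sound.glueCayley (hφ : ∀ i, Function.Injective (φ i)) [∀ i, Finite (X i)]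
    [∀ i, Finite (PresentedGroup (R i))] (h : Sound φ ws Γ) (e : Γ.E) :
    Sound φ ws (glueCayley R Γ e) where
  finite_V :=
    have := h.finite_V
    have : Finite (Γ.disjUnion (cayley R (Γ.color e))).V :=
      inferInstanceAs (Finite (Γ.V ⊕ PresentedGroup (R (Γ.color e))))
    .of_surjective (Quot.mk _) Quot.mk_surjective
  finite_E :=
    have := h.finite_E
    have : Finite (Γ.disjUnion (cayley R (Γ.color e))).E := inferInstanceAs
      (Finite (Γ.E ⊕ PresentedGroup (R (Γ.color e)) × (X (Γ.color e) × Bool)))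
    .of_surjective (Quot.mk _) Quot.mk_surjective
  connected := by
    refine LGraph.connected_of_base ((glueCayleyInl R Γ e).onV (Γ.ini e)) ?_
    rintro ⟨a | (g : PresentedGroup (R (Γ.color e)))⟩
    · obtain ⟨w, hw⟩ := h.connected.2 (Γ.ini e) a
      exact ⟨w, hw.map (glueCayleyInl R Γ e)⟩
    · have hg := (isOrbitMap_cayley (Γ.color e)).act hφ (1 : PresentedGroup (R (Γ.color e))) g
      rw [one_mul] at hg
      obtain ⟨w, hw, -⟩ := hg.map (glueCayleyInr R Γ e)
      rw [glueCayleyInr_one] at hw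
      exact ⟨w, hw.1⟩
  val_mem w hw := Lab.map (glueCayleyInl R Γ e) rfl (h.val_mem w hw)
  potential := by
    obtain ⟨p, hp, hp1⟩ := h.potential
    have hx : val φ [Γ.lab e] = PushoutI.of (φ := φ) (Γ.color e)
      (genVal R (Γ.gen e)) := val_letter φ (Γ.color e) (Γ.gen e)
    -- The vertex `g` is reached from the initial vertex of `e` by a path with value `g`, which
    -- forces its potential.
    refine ⟨Quot.lift (Sum.elim p fun g : PresentedGroup (R (Γ.color e)) =>
      (PushoutI.of (φ := φ) (Γ.color e) g)⁻¹ • p (Γ.ini e)) ?_, ?_, hp1⟩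
    · rintro _ _ (⟨rfl, rfl⟩ | ⟨rfl, rfl⟩)
      · change p (Γ.ini e) = (PushoutI.of (φ := φ) (Γ.color e) 1)⁻¹ • p (Γ.ini e)
        rw [map_one, inv_one, one_smul]
      · change p (Γ.ter e) = (PushoutI.of (φ := φ) (Γ.color e)
          (1 * genVal R (Γ.gen e)))⁻¹ • p (Γ.ini e)
        rw [one_mul, ← hx, hp e, inv_smul_smul]
    · rintro ⟨a | ⟨g, x⟩⟩
      · exact hp a
      · change (PushoutI.of (φ := φ) (Γ.color e) g)⁻¹ • p (Γ.ini e) =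
          val φ [letter (Γ.color e) x] •
            (PushoutI.of (φ := φ) (Γ.color e) (g * genVal R x))⁻¹ • p (Γ.ini e)
        rw [val_letter, smul_smul, map_mul, mul_inv_rev, mul_inv_cancel_left]

/-- The inclusion of the graph with a hair cut. -/
def cutHairHom (Γ : PGraph X) {e : Γ.E} (he : Γ.IsHair e) :
    (Γ.cutHair e he).Hom Γ.toLGraph where
  onV := Subtype.val
  onE := Subtype.val
  ini_onE _ := rfl
  rev_onE _ := rfl
  lab_onE _ := rfl

theorem cutHair_ini_ne {e : Γ.E} (he : Γ.IsHair e) : Γ.ini e ≠ Γ.ter e := fun h =>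
  Γ.rev_ne e (he.eq_rev h).symm

/-- A hair can only be traversed back and forth. The second clause serves the induction: it
describes a path already at the tip, with the traversal of `e` still owed to the value. -/
theorem cutHair_exists_path (φ : ∀ i, A →* PresentedGroup (R i)) {e : Γ.E} (he : Γ.IsHair e)
    {a b : Γ.V} {w : List (Letter X)} (hw : Γ.HasPath a w b) (hb : b ≠ Γ.ter e) :
    (∀ ha : a ≠ Γ.ter e, ∃ w', (Γ.cutHair e he).HasPath ⟨a, ha⟩ w' ⟨b, hb⟩ ∧
      val φ w' = val φ w) ∧
    (a = Γ.ter e → ∃ w', (Γ.cutHair e he).HasPath ⟨Γ.ini e, cutHair_ini_ne he⟩ w' ⟨b, hb⟩ ∧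
      val φ w' = val φ [Γ.lab e] * val φ w) := by
  induction hw with
  | nil a => exact ⟨fun ha => ⟨[], .nil _, rfl⟩, fun h => absurd h hb⟩
  | cons f h ih =>
    obtain ⟨ih₁, ih₂⟩ := ih hb
    constructor
    · intro ha
      rcases eq_or_ne f e with rfl | hfe
      · obtain ⟨w', hw', hv⟩ := ih₂ rfl
        exact ⟨w', hw', hv.trans (val_cons φ _ _).symm⟩
      · have hfr : f ≠ Γ.rev e := fun h => ha (by rw [h]; rfl)
        have ht : Γ.ter f ≠ Γ.ter e := fun h => hfe (by
          rw [← Γ.rev_rev f, he.eq_rev h, Γ.rev_rev])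
        obtain ⟨w', hw', hv⟩ := ih₁ ht
        exact ⟨Γ.lab f :: w', .cons (Γ := (Γ.cutHair e he).toLGraph) ⟨f, hfe, hfr⟩ hw', by
          rw [val_cons, hv, ← val_cons]⟩
    · intro ha
      obtain rfl := he.eq_rev ha
      rw [Γ.ter_rev] at ih₁
      obtain ⟨w', hw', hv⟩ := ih₁ (cutHair_ini_ne he)
      refine ⟨w', hw', ?_⟩
      rw [hv, val_cons φ (Γ.lab (Γ.rev _)), Γ.lab_rev, val_inv, mul_inv_cancel_left]

theorem Sound.cutHair (h : Sound φ ws Γ) {e : Γ.E} (he : Γ.IsHair e) :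
    Sound φ ws (Γ.cutHair e he) :=
  h.of_subgraph (cutHairHom Γ he) Subtype.val_injective Subtype.val_injective rfl
    fun a b _ hw => (cutHair_exists_path φ he hw b.2).1 a.2

/-- The inclusion of the graph with a component removed. -/
def removeCompHom (Γ : PGraph X) {e : Γ.E} (he : Γ.base ∉ Γ.compVM e) :
    (Γ.removeComp e he).Hom Γ.toLGraph where
  onV := Subtype.val
  onE := Subtype.val
  ini_onE _ := rfl
  rev_onE _ := rfl
  lab_onE _ := rfl

theorem notMem_compVM_of_inc {Γ : LGraph X} {e : Γ.E} {a : Γ.V} {j : Fin 2} (ha : Γ.Inc j a)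
    (hj : j ≠ Γ.color e) : a ∉ Γ.compVM e := by
  obtain ⟨f, hf, hc⟩ := ha
  exact fun h => hj (hc.symm.trans (h.2 f hf))

theorem mem_compVB_of_notMem_compVM {Γ : LGraph X} {e : Γ.E} {a : Γ.V} (ha : a ∈ Γ.compV e)
    (ha' : a ∉ Γ.compVM e) : a ∈ Γ.compVB e := by
  refine ⟨ha, ?_⟩
  by_contra h
  refine ha' ⟨ha, fun f hf => ?_⟩
  by_contra hc
  exact h (LGraph.mem_VB_of_ne hc ⟨f, hf, rfl⟩ (LGraph.compV_inc ha))

theorem removeComp_lift {e : Γ.E} (he : Γ.base ∉ Γ.compVM e) {j : Fin 2} (hj : j ≠ Γ.color e)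
    {a b : Γ.V} {w : List (Letter X)} (hw : Γ.HasMonoPath j a w b) (ha : a ∉ Γ.compVM e)
    (hb : b ∉ Γ.compVM e) : (Γ.removeComp e he).HasPath ⟨a, ha⟩ w ⟨b, hb⟩ := by
  obtain ⟨hw, hl⟩ := hw
  induction hw with
  | nil a => exact .nil _
  | cons f h ih =>
    have hf : Γ.color f = j := hl _ (List.mem_cons_self ..)
    have ht : Γ.ter f ∉ Γ.compVM e :=
      notMem_compVM_of_inc ⟨_, rfl, (Γ.color_rev f).trans hf⟩ hj
    exact .cons (Γ := (Γ.removeComp e he).toLGraph) ⟨f, fun h => hj (hf.symm.trans h.1)⟩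
      (ih ht hb fun l hm => hl l (List.mem_cons_of_mem _ hm))

/-- The second clause carries the induction: `c` is the bichromatic vertex at which the path entered
the removed component, and `g` is the value accumulated inside it. On leaving, this part is replaced
by a detour. -/
theorem Good.removeComp_exists_path (hφ : ∀ i, Function.Injective (φ i)) [Finite Γ.V]
    (hΓ : Good φ Γ.toLGraph) {e : Γ.E} (hr : Removable φ Γ e) (he : Γ.base ∉ Γ.compVM e)
    {a b : Γ.V} {w : List (Letter X)} (hw : Γ.HasPath a w b) (hb : b ∉ Γ.compVM e) :
    (∀ ha : a ∉ Γ.compVM e, ∃ w', (Γ.removeComp e he).HasPath ⟨a, ha⟩ w' ⟨b, hb⟩ ∧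
      val φ w' = val φ w) ∧
    (∀ c, c ∈ Γ.compVB e → ∀ (hc : c ∉ Γ.compVM e) (g : PresentedGroup (R (Γ.color e))),
      Act φ Γ.toLGraph (Γ.color e) c g a →
      ∃ w', (Γ.removeComp e he).HasPath ⟨c, hc⟩ w' ⟨b, hb⟩ ∧
        val φ w' = PushoutI.of (φ := φ) (Γ.color e) g * val φ w) := by
  -- Between bichromatic vertices the value lies in `A`, so the same element is realised by a path
  -- of the other colour, which survives the removal.
  have detour : ∀ c ∈ Γ.compVB e, ∀ d ∈ Γ.compVB e, ∀ (hc : c ∉ Γ.compVM e)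
      (hd : d ∉ Γ.compVM e) (g : PresentedGroup (R (Γ.color e))),
      Act φ Γ.toLGraph (Γ.color e) c g d →
      ∃ w', (Γ.removeComp e he).HasPath ⟨c, hc⟩ w' ⟨d, hd⟩ ∧
        val φ w' = PushoutI.of (φ := φ) (Γ.color e) g := by
    intro c hc d hd hc' hd' g hg
    obtain ⟨x, rfl⟩ := hΓ.mem_range_of_removable hφ hr hc hd hg
    have hj : 1 - Γ.color e ≠ Γ.color e := by omega
    obtain ⟨w', hw', hv⟩ := hΓ.convert hφ (1 - Γ.color e) (hc.2 _) hg
    refine ⟨w', removeComp_lift he hj hw' hc' hd', ?_⟩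
    rw [hv, PushoutI.of_apply_eq_base, PushoutI.of_apply_eq_base]
  induction hw with
  | nil a =>
    refine ⟨fun ha => ⟨[], .nil _, rfl⟩, fun c hc hc' g hg => ?_⟩
    obtain ⟨w', hw', hv⟩ :=
      detour c hc a (mem_compVB_of_notMem_compVM (hg.mem_compV hc.1) hb) hc' hb g hg
    exact ⟨w', hw', by rw [hv, val_nil, mul_one]⟩
  | @cons f w b h ih =>
    obtain ⟨ih₁, ih₂⟩ := ih hb
    have step : ∀ (_ : f ∉ Γ.compE e) (ha : Γ.ini f ∉ Γ.compVM e),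
        ∃ w', (Γ.removeComp e he).HasPath ⟨Γ.ini f, ha⟩ w' ⟨b, hb⟩ ∧
          val φ w' = val φ (Γ.lab f :: w) := by
      intro hf ha
      have ht : Γ.ter f ∉ Γ.compVM e := fun ht => hf (by
        have h1 : Γ.rev f ∈ Γ.compE e := ⟨ht.2 _ rfl, ht.1⟩
        simpa only [Γ.rev_rev] using LGraph.rev_mem_compE h1)
      obtain ⟨w', hw', hv⟩ := ih₁ ht
      exact ⟨Γ.lab f :: w', .cons (Γ := (Γ.removeComp e he).toLGraph) ⟨f, hf⟩ hw', by
        rw [val_cons, hv, ← val_cons]⟩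
    have second : ∀ c, c ∈ Γ.compVB e → ∀ (hc : c ∉ Γ.compVM e)
        (g : PresentedGroup (R (Γ.color e))), Act φ Γ.toLGraph (Γ.color e) c g (Γ.ini f) →
        ∃ w', (Γ.removeComp e he).HasPath ⟨c, hc⟩ w' ⟨b, hb⟩ ∧
          val φ w' = PushoutI.of (φ := φ) (Γ.color e) g * val φ (Γ.lab f :: w) := by
      intro c hc hc' g hg
      by_cases hf : Γ.color f = Γ.color e
      · obtain ⟨x, hx⟩ := Letter.exists_eq (l := Γ.lab f) hf
        obtain ⟨w', hw', hv⟩ := ih₂ c hc hc' _ (hg.trans (.edge f hx))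
        exact ⟨w', hw', by rw [hv, val_cons, hx, val_letter, map_mul, mul_assoc]⟩
      · have ha := notMem_compVM_of_inc (Γ := Γ.toLGraph) ⟨f, rfl, rfl⟩ hf
        obtain ⟨u, hu, hv⟩ := detour c hc _
          (mem_compVB_of_notMem_compVM (hg.mem_compV hc.1) ha) hc' ha g hg
        obtain ⟨w', hw', hv'⟩ := step (fun h => hf h.1) ha
        exact ⟨u ++ w', hu.append hw', by rw [val_append, hv, hv']⟩
    refine ⟨fun ha => ?_, second⟩
    -- A surviving vertex of the removed component is bichromatic and counts as an entry point with
    -- accumulated value `1`.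
    by_cases hc : Γ.ini f ∈ Γ.compV e
    · obtain ⟨w', hw', hv⟩ := second _ (mem_compVB_of_notMem_compVM hc ha) ha 1 (.refl _ _)
      exact ⟨w', hw', by rw [hv, map_one, one_mul]⟩
    · exact step (fun h => hc h.2) ha

theorem Sound.removeComp (hφ : ∀ i, Function.Injective (φ i)) (h : Sound φ ws Γ)
    (hΓ : Good φ Γ.toLGraph) {e : Γ.E} (hr : Removable φ Γ e) (he : Γ.base ∉ Γ.compVM e) :
    Sound φ ws (Γ.removeComp e he) :=
  have := h.finite_V
  h.of_subgraph (removeCompHom Γ he) Subtype.val_injective Subtype.val_injective rfl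
    fun a b _ hw => (hΓ.removeComp_exists_path hφ hr he hw b.2).1 a.2

/-- Every other component survives entirely, so its orbit maps take values in the smaller graph;
being `G`-based is inherited by subgraphs. -/
theorem Good.removeComp (hφ : ∀ i, Function.Injective (φ i)) (hΓ : Good φ Γ.toLGraph)
    {e : Γ.E} (he : Γ.base ∉ Γ.compVM e) (hc : (Γ.removeComp e he).Connected) :
    Good φ (Γ.removeComp e he).toLGraph where
  connected := hc
  gBased a b w hw hv := Subtype.ext (hΓ.gBased _ _ w (hw.map (removeCompHom Γ he)) hv)
  cover := by
    refine ⟨fun f f' h h' => Subtype.ext (hΓ.cover.wl _ _ (congrArg Subtype.val h) h'), ?_⟩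
    rintro k _ ⟨⟨f, hf⟩, rfl, rfl⟩
    obtain ⟨m, hm, hm1⟩ := hΓ.cover.covAt (Γ.color f) (Γ.ini f) ⟨f, rfl, rfl⟩
    have hE : ∀ f' g, Γ.ini f' = m g → Γ.color f' = Γ.color f → f' ∉ Γ.compE e := by
      rintro f' g hi hk ⟨hk', ha⟩
      refine hf ⟨hk.symm.trans hk', ?_⟩
      obtain ⟨w, hw, -⟩ := (hm.act hφ 1 g).symm
      rw [one_mul, hm1, ← hi, ← hk, hk'] at hw
      exact LGraph.compV_of_path ha hw
    have hV : ∀ g, m g ∉ Γ.compVM e := by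
      intro g
      -- Any letter of this colour will do: it gives a surviving edge at `m g`, so that this vertex
      -- is kept.
      obtain ⟨x, -⟩ := Letter.exists_eq (i := Γ.color f) (l := Γ.lab f) rfl
      obtain ⟨f', h1, h2, -⟩ := hm g x
      have hf' := hE f' g h1 (by rw [LGraph.color, h2]; rfl)
      exact fun h => hf' ⟨h.2 _ h1, h1 ▸ h.1⟩
    refine ⟨fun g => ⟨m g, hV g⟩, fun g x => ?_, Subtype.ext hm1⟩
    obtain ⟨f', h1, h2, h3⟩ := hm g x
    exact ⟨⟨f', hE f' g h1 (by rw [LGraph.color, h2]; rfl)⟩, Subtype.ext h1, h2, Subtype.ext h3⟩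

theorem trivial_connected : (PGraph.trivial X).Connected :=
  ⟨⟨PUnit.unit⟩, fun _ _ => ⟨[], .nil _⟩⟩

theorem trivial_good : Good φ (PGraph.trivial X).toLGraph where
  connected := trivial_connected
  gBased _ _ _ _ _ := rfl
  cover := ⟨fun e => e.elim, by rintro _ _ ⟨e, -⟩; exact e.elim⟩

/-- Closed paths in the Cayley graph of a factor have trivial value, so all input words represent
`1`. -/
theorem Sound.trivial (h : Sound φ ws Γ)
    (hc : IsCayley R Γ) : Sound φ ws (PGraph.trivial X) where
  finite_V := inferInstanceAs (Finite PUnit)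
  finite_E := inferInstanceAs (Finite PEmpty)
  connected := trivial_connected
  potential := ⟨fun _ => QuotientGroup.mk 1, fun e => e.elim, rfl⟩
  val_mem w hw := by
    refine ⟨[], .nil _, ?_⟩
    obtain ⟨w', hw', hv⟩ := h.val_mem w hw
    obtain ⟨-, i, f, hf⟩ := hc
    have h1 := (hw'.map f.toHom).map (cayleyIso i).toHom
    rw [show f.toHom.onV Γ.base = _ from hf] at h1
    have hl : ∀ {a b w}, (relCayley (R := R) (i := i) ⊥).HasPath a w b →
        ∀ l ∈ w, l.color = i := by
      intro a b w h
      induction h with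
      | nil => simp
      | cons e _ ih => exact List.forall_mem_cons.2 ⟨rfl, ih⟩
    obtain ⟨g, hg, hp⟩ := (isOrbitMap_coset (R := R) (i := i) ⊥).exists_of_path φ
      (relCayley_wellLabelled _) ⟨h1, hl h1⟩ 1 rfl
    have : (1 : PresentedGroup (R i)) = 1 * g := coset_bot_injective hp
    rw [one_mul] at this
    rw [val_nil, ← hv, hg, ← this, map_one]

end Sound

/-! ### The bouquet of the input words. -/

section Bouquet

variable {X : Fin 2 → Type u} {R : ∀ i, Set (FreeGroup (X i))} {A : Type v} [Group A]
  {φ : ∀ i, A →* PresentedGroup (R i)} {ws : List (List (Letter X))}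

open Monoid (PushoutI)
open PGraph

theorem bouquetNode_zero (j : Fin ws.length) : bouquetNode ws j 0 = none := by
  simp [bouquetNode]

theorem bouquetNode_length (j : Fin ws.length) :
    bouquetNode ws j (ws.get j).length = none := by
  simp [bouquetNode]

theorem bouquet_hasPath (j : Fin ws.length) {k : ℕ} (hk : k ≤ (ws.get j).length) :
    (bouquet ws).HasPath (bouquet ws).base ((ws.get j).take k) ⟨bouquetNode ws j k⟩ := by
  induction k with
  | zero =>
    rw [bouquetNode_zero]
    exact .nil _
  | succ k ih =>
    rw [← List.take_concat_get' _ _ hk]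
    exact (ih (Nat.le_of_succ_le hk)).snoc (Γ := (bouquet ws).toLGraph) ⟨(⟨j, ⟨k, hk⟩⟩, true)⟩ rfl

theorem IsPotential.of_rev {Γ : LGraph X} {p : Γ.V → PushoutI φ ⧸ inputSubgroup φ ws}
    (h : ∀ e, p (Γ.ini e) = val φ [Γ.lab e] • p (Γ.ter e) ∨
      p (Γ.ter e) = val φ [Γ.lab (Γ.rev e)] • p (Γ.ini e)) : IsPotential φ ws Γ p := by
  intro e
  rcases h e with h | h
  · exact h
  · rw [h, Γ.lab_rev, val_inv, smul_inv_smul]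

theorem sound_bouquet : Sound φ ws (bouquet ws) where
  finite_V := by
    have : Finite {p : Fin ws.length × ℕ // 0 < p.2 ∧ p.2 < (ws.get p.1).length} :=
      .of_injective (β := Σ j : Fin ws.length, Fin (ws.get j).length)
        (fun p => ⟨p.1.1, ⟨p.1.2, p.2.2⟩⟩) (by
          rintro ⟨⟨j, k⟩, hk⟩ ⟨⟨j', k'⟩, hk'⟩ h
          simp only [Sigma.mk.injEq] at h
          obtain ⟨rfl, h⟩ := h
          simpa using h)
    exact inferInstanceAs (Finite (ULift (Option _)))
  finite_E := inferInstanceAs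
    (Finite (ULift ((Σ j : Fin ws.length, Fin (ws.get j).length) × Bool)))
  connected := by
    refine LGraph.connected_of_base (bouquet ws).base ?_
    rintro ⟨_ | ⟨⟨j, k⟩, hk⟩⟩
    · exact ⟨[], .nil _⟩
    · have := bouquet_hasPath j hk.2.le
      rw [bouquetNode, dif_pos hk] at this
      exact ⟨_, this⟩
  val_mem w hw := by
    obtain ⟨j, rfl⟩ := List.get_of_mem hw
    have := bouquet_hasPath j le_rfl
    rw [bouquetNode_length, List.take_length] at this
    exact ⟨_, this, rfl⟩
  potential := by
    -- The potential at the end of a prefix is forced by the prefix. It is consistent at the end of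
    -- each loop because the whole word represents an element of `H`.
    let q : Fin ws.length → ℕ → PushoutI φ ⧸ inputSubgroup φ ws := fun j k =>
      (val φ ((ws.get j).take k))⁻¹ • QuotientGroup.mk 1
    let p : (bouquet ws).V → PushoutI φ ⧸ inputSubgroup φ ws := fun a =>
      a.down.elim (QuotientGroup.mk 1) fun x => q x.1.1 x.1.2
    have hp : ∀ j k, k ≤ (ws.get j).length → p ⟨bouquetNode ws j k⟩ = q j k := by
      intro j k hk
      by_cases h : 0 < k ∧ k < (ws.get j).length
      · rw [bouquetNode, dif_pos h]
        rfl
      · rw [bouquetNode, dif_neg h]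
        change QuotientGroup.mk 1 = (val φ ((ws.get j).take k))⁻¹ • QuotientGroup.mk 1
        rcases Nat.eq_zero_or_pos k with rfl | hk'
        · rw [List.take_zero, val_nil, inv_one, one_smul]
        · rw [List.take_of_length_le (by omega), MulAction.Quotient.smul_mk, QuotientGroup.eq]
          simp only [smul_eq_mul, mul_one, inv_one, one_mul, inv_mem_iff]
          exact Subgroup.subset_closure ⟨_, List.get_mem ws j, rfl⟩
    have hq : ∀ (j : Fin ws.length) (k : Fin (ws.get j).length),
        q j k = val φ [(ws.get j).get k] • q j (k + 1) := by
      intro j k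
      change (val φ ((ws.get j).take k))⁻¹ • _ =
        val φ [(ws.get j)[(k : ℕ)]] • (val φ ((ws.get j).take (k + 1)))⁻¹ • _
      rw [← List.take_concat_get' _ _ k.2, val_append, mul_inv_rev, smul_smul,
        mul_inv_cancel_left]
    refine ⟨p, .of_rev ?_, rfl⟩
    rintro ⟨⟨j, k⟩, _ | _⟩
    · refine .inr ?_
      exact (hp j k k.2.le).trans ((hq j k).trans (congrArg _ (hp j _ k.2).symm))
    · refine .inl ?_
      exact (hp j k k.2.le).trans ((hq j k).trans (congrArg _ (hp j _ k.2).symm))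

end Bouquet

/-! ### Steps 3 and 4: attaching Cayley graphs and resolving conflicts. -/

section Steps

variable {X : Fin 2 → Type u} {R : ∀ i, Set (FreeGroup (X i))} {A : Type v} [Group A]
  {φ : ∀ i, A →* PresentedGroup (R i)} {Γ : PGraph X}

open Monoid (PushoutI)

theorem quot_eq_of_pair {α : Type*} {r : α → α → Prop} {x y : α}
    (hr : ∀ a b, r a b → a = b ∨ (a = x ∧ b = y)) {a b : α} (h : Quot.mk r a = Quot.mk r b) :
    a = b ∨ ((a = x ∨ a = y) ∧ (b = x ∨ b = y)) := by
  replace h := Quot.eqvGen_exact h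
  induction h with
  | rel a b h => exact (hr a b h).imp_right fun h => ⟨.inl h.1, .inr h.2⟩
  | refl a => exact .inl rfl
  | symm a b _ ih => exact ih.imp Eq.symm And.symm
  | trans a b c _ _ ih ih' =>
    grind

/-- Every monochromatic component contains one of the listed edges or a vertex at which
a Cayley graph is attached. -/
def CoversOrListed (R : ∀ i, Set (FreeGroup (X i))) (Γ : LGraph X) (L : List Γ.E) : Prop :=
  ∀ e, ∃ a ∈ Γ.compV e, CovAt R Γ (Γ.color e) a ∨ ∃ f ∈ L, Γ.ini f = a ∧ Γ.color f = Γ.color e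

theorem CoversOrListed.map {Γ Δ : LGraph X} {L : List Γ.E} (h : CoversOrListed R Γ L)
    (f : Γ.Hom Δ) (hf : Function.Surjective f.onE) : CoversOrListed R Δ (L.map f.onE) := by
  intro e
  obtain ⟨e, rfl⟩ := hf e
  obtain ⟨a, ha, hL⟩ := h e
  refine ⟨f.onV a, LGraph.compV_map f ha, ?_⟩
  rw [f.color_onE]
  refine hL.imp (fun h => h.map f) ?_
  rintro ⟨e', he', rfl, hc⟩
  exact ⟨f.onE e', List.mem_map_of_mem he', f.ini_onE e', by rw [f.color_onE, hc]⟩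

theorem PicksEdges.coversOrListed {Γ : LGraph X} {L : List Γ.E} (hL : PicksEdges Γ L) :
    CoversOrListed R Γ L := by
  intro e
  obtain ⟨k, hk, -⟩ := hL e
  exact ⟨_, hk.2, .inr ⟨_, List.get_mem L k, rfl, hk.1⟩⟩

/-- The component that loses its listed edge now contains the image of the identity of the Cayley
graph, at the initial vertex of that edge. -/
theorem CoversOrListed.glueCayley {e : Γ.E} {L : List Γ.E}
    (h : CoversOrListed R Γ.toLGraph (e :: L)) :
    CoversOrListed R (glueCayley R Γ e).toLGraph (L.map (glueCayleyE R Γ e)) := by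
  let f := glueCayleyInl R Γ e
  rintro ⟨d | ⟨g, x⟩⟩
  · obtain ⟨a, ha, hL⟩ := h d
    refine ⟨f.onV a, LGraph.compV_map f ha, ?_⟩
    rcases hL with h | ⟨e', he', rfl, hc⟩
    · exact .inl (h.map f)
    · rcases List.mem_cons.1 he' with rfl | he'
      · left
        have := covAt_glueCayleyInr (R := R) e' 1
        rw [glueCayleyInr_one, hc] at this
        exact this
      · exact .inr ⟨f.onE e', List.mem_map_of_mem he', rfl, hc⟩
  · exact ⟨_, LGraph.ini_mem_compV _, .inl (covAt_glueCayleyInr e g)⟩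

variable (φ) in
/-- Every bichromatic vertex is in the orbit under the amalgamated subgroup, in both colours, of
a vertex in `B`. -/
def ReachedFrom (Γ : LGraph X) (B : Set Γ.V) : Prop :=
  ∀ d ∈ Γ.VB, ∃ c ∈ B, ∃ x : A, ∀ i, Act φ Γ i c (φ i x) d

theorem reachedFrom_VB (Γ : LGraph X) : ReachedFrom φ Γ Γ.VB :=
  fun d hd => ⟨d, hd, 1, fun i => by rw [map_one]; exact .refl i d⟩

/-- Folding creates no new bichromatic vertices: the two merged ends both carry the colour of the
folded edges, so if the result is bichromatic, one of them already was. -/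
theorem ReachedFrom.fold {B : Set Γ.V} (h : ReachedFrom φ Γ.toLGraph B) {e f : Γ.E}
    (hef : Γ.Foldable e f) :
    ReachedFrom φ (Γ.fold e f hef).toLGraph (Γ.foldV e f hef '' B) := by
  let q := Γ.identEdgesHom e f hef.lab_eq
  have key : ∀ a ∈ Γ.VB, ∃ c ∈ Γ.foldV e f hef '' B, ∃ x : A, ∀ i,
      Act φ (Γ.fold e f hef).toLGraph i c (φ i x) (q.onV a) := by
    intro a ha
    obtain ⟨c, hc, x, hx⟩ := h a ha
    exact ⟨_, ⟨c, hc, rfl⟩, x, fun i => (hx i).map q⟩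
  intro d hd
  obtain ⟨⟨f₀⟩, h₀, hc₀⟩ := hd 0
  obtain ⟨⟨f₁⟩, h₁, hc₁⟩ := hd 1
  have hc₀ : Γ.color f₀ = 0 := hc₀
  have hc₁ : Γ.color f₁ = 1 := hc₁
  have h₀ : q.onV (Γ.ini f₀) = d := h₀
  have h₁ : q.onV (Γ.ini f₁) = d := h₁
  have hcf : Γ.color f = Γ.color e := congrArg Letter.color hef.lab_eq.symm
  have hinc : ∀ a, a = Γ.ter e ∨ a = Γ.ter f → Γ.Inc (Γ.color e) a := by
    rintro a (rfl | rfl)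
    · exact ⟨_, rfl, Γ.color_rev e⟩
    · exact ⟨_, rfl, (Γ.color_rev f).trans hcf⟩
  rcases quot_eq_of_pair (x := Γ.ter e) (y := Γ.ter f) (by
    rintro a b (⟨rfl, rfl⟩ | ⟨rfl, rfl⟩)
    · exact .inl hef.ini_eq
    · exact .inr ⟨rfl, rfl⟩) (h₀.trans h₁.symm) with h | ⟨ha₀, ha₁⟩
  · rw [← h₀]
    exact key _ (LGraph.mem_VB_of_ne zero_ne_one ⟨f₀, rfl, hc₀⟩ ⟨f₁, h.symm, hc₁⟩)
  · obtain hc | hc : Γ.color e = 0 ∨ Γ.color e = 1 := by omega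
    · rw [← h₁]
      exact key _ (LGraph.mem_VB_of_ne zero_ne_one (hc ▸ hinc _ ha₁) ⟨f₁, rfl, hc₁⟩)
    · rw [← h₀]
      exact key _ (LGraph.mem_VB_of_ne zero_ne_one ⟨f₀, rfl, hc₀⟩ (hc ▸ hinc _ ha₀))

theorem Conflict.exists_act {Γ : LGraph X} {c a b : Γ.V}
    (h : Conflict φ Γ c a b) : ∃ x, Act φ Γ 0 c (φ 0 x) a ∧ Act φ Γ 1 c (φ 1 x) b := by
  obtain ⟨-, w, w', hw, hw', ⟨x, hx⟩, -, hv⟩ := h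
  exact ⟨x, ⟨w, hw, by rw [← hx, PushoutI.of_apply_eq_base]⟩,
    ⟨w', hw', by rw [← hv, ← hx, PushoutI.of_apply_eq_base]⟩⟩

theorem conflict_of_act {Γ : LGraph X} {c a b : Γ.V} (hab : a ≠ b) {x : A}
    (h : Act φ Γ 0 c (φ 0 x) a) (h' : Act φ Γ 1 c (φ 1 x) b) : Conflict φ Γ c a b := by
  obtain ⟨w, hw, hv⟩ := h
  obtain ⟨w', hw', hv'⟩ := h'
  rw [PushoutI.of_apply_eq_base] at hv hv'
  exact ⟨hab, w, w', hw, hw', ⟨x, hv.symm⟩, ⟨x, hv'.symm⟩, hv.trans hv'.symm⟩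

/-- An identification may create a bichromatic vertex, but then it is the common image of `a` and
`b`, which is reached from `c` by the same element of `A` in both colours. This is why step 4 need
only inspect the images of the bichromatic vertices of the graph after step 3. -/
theorem ReachedFrom.identify {B : Set Γ.V}
    (h : ReachedFrom φ Γ.toLGraph B) {c a b : Γ.V}
    (hc : c ∈ B) (hcon : Conflict φ Γ.toLGraph c a b) :
    ReachedFrom φ (Γ.identify a b).toLGraph (Γ.identifyV a b '' B) := by
  let q := Γ.identVertsHom fun c d => c = a ∧ d = b
  have hab : q.onV a = q.onV b := Quot.sound ⟨rfl, rfl⟩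
  intro d hd
  obtain ⟨f₀, h₀, hc₀⟩ := hd 0
  obtain ⟨f₁, h₁, hc₁⟩ := hd 1
  rcases quot_eq_of_pair (fun _ _ => .inr) (h₀.trans h₁.symm) with h' | ⟨ha₀, -⟩
  · obtain ⟨c', hc', x, hx⟩ :=
      h _ (LGraph.mem_VB_of_ne zero_ne_one ⟨f₀, rfl, hc₀⟩ ⟨f₁, h'.symm, hc₁⟩)
    rw [← h₀]
    exact ⟨_, ⟨c', hc', rfl⟩, x, fun i => (hx i).map q⟩
  · have hd : d = q.onV a := by
      rw [← h₀]
      rcases ha₀ with h | h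
      · exact congrArg q.onV h
      · exact (congrArg q.onV h).trans hab.symm
    obtain ⟨x, hx₀, hx₁⟩ := hcon.exists_act
    refine ⟨_, ⟨c, hc, rfl⟩, x, fun i => ?_⟩
    rw [hd]
    obtain rfl | rfl : i = 0 ∨ i = 1 := by omega
    · exact hx₀.map q
    · rw [hab]
      exact hx₁.map q

/-- A disagreement at a bichromatic vertex is moved back, by composing with the path from `B` in
each colour, to a conflict at a vertex of `B`. -/
theorem ReachedFrom.noConflict {Γ : LGraph X} {B : Set Γ.V} (h : ReachedFrom φ Γ B) (hB : ∀ c ∈ B, ∀ a b, ¬ Conflict φ Γ c a b) : NoConflict φ Γ := by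
  have key : ∀ d ∈ Γ.VB, ∀ y a b, Act φ Γ 0 d (φ 0 y) a → Act φ Γ 1 d (φ 1 y) b → a = b := by
    intro d hd y a b ha hb
    obtain ⟨c, hc, x, hx⟩ := h d hd
    by_contra hab
    have h₀ := (hx 0).trans ha
    have h₁ := (hx 1).trans hb
    rw [← map_mul] at h₀ h₁
    exact hB c hc a b (conflict_of_act hab h₀ h₁)
  intro d hd i j x b c hij hb hc
  obtain ⟨rfl, rfl⟩ | ⟨rfl, rfl⟩ : (i = 0 ∧ j = 1) ∨ (i = 1 ∧ j = 0) := by omega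
  · exact key d hd x b c hb hc
  · exact (key d hd x c b hc hb).symm

end Steps

/-! ### Step 6: gluing a relative Cayley graph along the orbit of the basepoint. -/

section GlueRel

/-- If the identifications come from a partial bijection between the summands, the generated
equivalence adds nothing: neither summand is collapsed. -/
theorem quot_sum_rel {α β : Type*} {r : α ⊕ β → α ⊕ β → Prop} {s : α → β → Prop}
    (hr : ∀ p q, r p q → ∃ a b, s a b ∧ p = .inl a ∧ q = .inr b)
    (h₁ : ∀ a b c, s a b → s a c → b = c) (h₂ : ∀ a b c, s a c → s b c → a = b)
    {p q : α ⊕ β} (h : Quot.mk r p = Quot.mk r q) :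
    (∀ a b, p = .inl a → q = .inl b → a = b) ∧ (∀ a b, p = .inr a → q = .inr b → a = b) ∧
    (∀ a b, p = .inl a → q = .inr b → s a b) ∧ (∀ a b, p = .inr b → q = .inl a → s a b) := by
  replace h := Quot.eqvGen_exact h
  induction h with
  | rel p q h =>
    obtain ⟨a, b, hs, rfl, rfl⟩ := hr p q h
    simpa using hs
  | refl p => cases p <;> simp
  | symm p q _ ih =>
    obtain ⟨i₁, i₂, i₃, i₄⟩ := ih
    exact ⟨fun a b ha hb => (i₁ b a hb ha).symm, fun a b ha hb => (i₂ b a hb ha).symm,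
      fun a b ha hb => i₄ a b hb ha, fun a b ha hb => i₃ a b hb ha⟩
  | trans p q t _ _ ih ih' =>
    rcases p with p | p <;> rcases q with q | q <;> rcases t with t | t <;>
      simp at ih ih' ⊢ <;> grind

variable {X : Fin 2 → Type u} {R : ∀ i, Set (FreeGroup (X i))} {A : Type v} [Group A]
  {φ : ∀ i, A →* PresentedGroup (R i)} {ws : List (List (Letter X))} {Γ : PGraph X}
  {i j : Fin 2} {L : Subgroup (PresentedGroup (R j))}

open Monoid (PushoutI)

variable (φ Γ i L) in
/-- The hypotheses on the basepoint under which a relative Cayley graph is glued along its orbit. -/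
structure GlueData : Prop where
  ne : i ≠ j
  mono : Γ.Monochromatic i Γ.base
  inc : Γ.Inc i Γ.base
  le_range : L ≤ (φ j).range
  mem_iff : ∀ x, φ j x ∈ L ↔ Act φ Γ.toLGraph i Γ.base (φ i x) Γ.base
  exists_ne : ∃ x, φ j x ∈ L ∧ x ≠ 1

theorem NeedsGlue.glueData (hφ : ∀ i, Function.Injective (φ i)) {e : Γ.E}
    {K : Subgroup (PresentedGroup (R (Γ.color e)))} (h : NeedsGlue φ Γ e K)
    (hj : j ≠ Γ.color e) :
    GlueData φ Γ (Γ.color e) ((K.comap (φ (Γ.color e))).map (φ j)) := by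
  obtain ⟨hm, hK, hne⟩ := h
  obtain ⟨hb, rfl⟩ := hK.eq_stab hφ
  refine ⟨hj.symm, hm, LGraph.compV_inc hb, ?_, fun x => ?_, ?_⟩
  · rintro _ ⟨x, -, rfl⟩
    exact ⟨x, rfl⟩
  · exact Subgroup.mem_map_iff_mem (hφ j)
  · obtain ⟨x, hx, hx1⟩ := (Subgroup.bot_or_exists_ne_one _).resolve_left hne
    exact ⟨x, ⟨x, hx, rfl⟩, hx1⟩

theorem glueRel_iff {c d : (Γ.toLGraph.disjUnion (relCayley L)).V} :
    GlueRel φ Γ i L c d ↔ ∃ x b, Act φ Γ.toLGraph i Γ.base (φ i x) b ∧ c = Sum.inl b ∧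
      d = Sum.inr (coset L (φ j x)) := by
  simp only [GlueRel, Act, PushoutI.of_apply_eq_base]
  constructor
  · rintro ⟨x, b, w, hw, hv, h⟩
    exact ⟨x, b, ⟨w, hw, hv⟩, h⟩
  · rintro ⟨x, b, ⟨w, hw, hv⟩, h⟩
    exact ⟨x, b, w, hw, hv, h⟩

variable (φ Γ i L) in
/-- The morphism from the original graph to the graph with a relative Cayley graph glued on. -/
def glueInl : Γ.Hom (glueRelCayley φ Γ i L).toLGraph :=
  ((Γ.toLGraph.disjUnion (relCayley L)).identVertsHom (GlueRel φ Γ i L)).comp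
    (Γ.inlHom (relCayley L))

variable (φ Γ i L) in
/-- The morphism from the relative Cayley graph that is glued on. -/
def glueInr : (relCayley L).Hom (glueRelCayley φ Γ i L).toLGraph :=
  ((Γ.toLGraph.disjUnion (relCayley L)).identVertsHom (GlueRel φ Γ i L)).comp
    (Γ.inrHom (relCayley L))

theorem glueInl_eq_glueInr {x : A} {b : Γ.V} (h : Act φ Γ.toLGraph i Γ.base (φ i x) b) :
    (glueInl φ Γ i L).onV b = (glueInr φ Γ i L).onV (coset L (φ j x)) :=
  Quot.sound (r := GlueRel φ Γ i L) (glueRel_iff.2 ⟨x, b, h, rfl, rfl⟩)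

theorem glueInl_base :
    (glueInl φ Γ i L).onV Γ.base = (glueInr φ Γ i L).onV (coset L 1) := by
  rw [glueInl_eq_glueInr (x := 1) (by rw [map_one]; exact .refl _ _), map_one]

theorem act_glueInr (hφ : ∀ i, Function.Injective (φ i)) (g h : PresentedGroup (R j)) :
    Act φ (glueRelCayley φ Γ i L).toLGraph j ((glueInr φ Γ i L).onV (coset L g)) h
      ((glueInr φ Γ i L).onV (coset L (g * h))) :=
  ((isOrbitMap_coset L).act hφ g h).map _

theorem Act.glueInl {k : Fin 2} {a b : Γ.V} {g : PresentedGroup (R k)}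
    (h : Act φ Γ.toLGraph k a g b) :
    Act φ (glueRelCayley φ Γ i L).toLGraph k ((glueInl φ Γ i L).onV a) g
      ((glueInl φ Γ i L).onV b) := h.map _

/-- The basepoint and the coset `L · 1` have the same stabilizer in `A`, so matching their
`A`-orbits is a partial bijection. -/
theorem GlueData.quot (hd : GlueData φ Γ i L) (hφ : ∀ i, Function.Injective (φ i))
    (hΓ : Good φ Γ.toLGraph) {p q : Γ.V ⊕ (relCayley L).V}
    (h : Quot.mk (GlueRel φ Γ i L) p = Quot.mk (GlueRel φ Γ i L) q) :
    (∀ a b, p = .inl a → q = .inl b → a = b) ∧ (∀ a b, p = .inr a → q = .inr b → a = b) ∧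
    (∀ a b, p = .inl a → q = .inr b → ∃ x, Act φ Γ.toLGraph i Γ.base (φ i x) a ∧
      b = coset L (φ j x)) := by
  have key : ∀ x y, coset L (φ j x) = coset L (φ j y) ↔
      Act φ Γ.toLGraph i Γ.base (φ i (y * x⁻¹)) Γ.base := fun x y => by
    rw [coset_eq_iff, ← map_inv, ← map_mul, hd.mem_iff]
  obtain ⟨h₁, h₂, h₃, -⟩ := quot_sum_rel
    (s := fun a b => ∃ x, Act φ Γ.toLGraph i Γ.base (φ i x) a ∧ b = coset L (φ j x))
    (fun p q h => by
      obtain ⟨x, b, h, hp, hq⟩ := glueRel_iff.1 h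
      exact ⟨b, _, ⟨x, h, rfl⟩, hp, hq⟩)
    (by
      rintro a _ _ ⟨x, hx, rfl⟩ ⟨y, hy, rfl⟩
      rw [key, map_mul, map_inv]
      exact hy.trans hx.symm)
    (by
      rintro a b _ ⟨x, hx, rfl⟩ ⟨y, hy, hxy⟩
      rw [key] at hxy
      have := hxy.trans hx
      rw [← map_mul, inv_mul_cancel_right] at this
      exact hΓ.cover.unique hφ this hy) h
  exact ⟨h₁, h₂, h₃⟩

theorem GlueData.inl_injective (hd : GlueData φ Γ i L) (hφ : ∀ i, Function.Injective (φ i))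
    (hΓ : Good φ Γ.toLGraph) : Function.Injective (glueInl φ Γ i L).onV := fun _ _ h =>
  (hd.quot hφ hΓ h).1 _ _ rfl rfl

theorem GlueData.inr_injective (hd : GlueData φ Γ i L) (hφ : ∀ i, Function.Injective (φ i))
    (hΓ : Good φ Γ.toLGraph) : Function.Injective (glueInr φ Γ i L).onV := fun _ _ h =>
  (hd.quot hφ hΓ h).2.1 _ _ rfl rfl

theorem GlueData.exists_of_inl_eq_inr (hd : GlueData φ Γ i L) (hφ : ∀ i, Function.Injective (φ i))
    (hΓ : Good φ Γ.toLGraph) {a : Γ.V} {c : (relCayley L).V}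
    (h : (glueInl φ Γ i L).onV a = (glueInr φ Γ i L).onV c) :
    ∃ x, Act φ Γ.toLGraph i Γ.base (φ i x) a ∧ c = coset L (φ j x) :=
  (hd.quot hφ hΓ h).2.2 _ _ rfl rfl

/-- Bichromatic vertices form a union of `A`-orbits, so the orbit of the monochromatic basepoint
contains none. Hence no edge of colour `j` of the old graph starts where the new graph is glued, and
no folding is needed. -/
theorem GlueData.mono_of_act (hd : GlueData φ Γ i L) (hφ : ∀ i, Function.Injective (φ i))
    (hΓ : Good φ Γ.toLGraph) {x : A} {a : Γ.V} (h : Act φ Γ.toLGraph i Γ.base (φ i x) a) :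
    Γ.Monochromatic i a := by
  intro f hf
  by_contra hc
  have hf' : Γ.Inc (Γ.color f) a := ⟨f, hf, rfl⟩
  have ha : a ∈ Γ.VB := LGraph.mem_VB_of_ne hc hf' (h.inc hd.inc)
  have h' := h.symm
  rw [← map_inv] at h'
  obtain ⟨f', hf', hc'⟩ := (hΓ.mem_VB_of_act hφ ha h') j
  exact hd.ne ((hd.mono f' hf').symm.trans hc')

theorem GlueData.cover (hd : GlueData φ Γ i L) (hφ : ∀ i, Function.Injective (φ i))
    (hΓ : Good φ Γ.toLGraph) : Cover R (glueRelCayley φ Γ i L).toLGraph := by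
  have mixed : ∀ (f : Γ.E) (f' : (relCayley L).E),
      (glueInl φ Γ i L).onV (Γ.ini f) = (glueInr φ Γ i L).onV ((relCayley L).ini f') →
      Γ.lab f = (relCayley L).lab f' → False := by
    intro f f' h h'
    obtain ⟨x, hx, -⟩ := hd.exists_of_inl_eq_inr hφ hΓ h
    exact hd.ne ((hd.mono_of_act hφ hΓ hx f rfl).symm.trans (congrArg Letter.color h'))
  refine .of_exists ?_ ?_
  · rintro (f | f) (f' | f') h h'
    · exact congrArg Sum.inl (hΓ.cover.wl _ _ (hd.inl_injective hφ hΓ h) h')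
    · exact (mixed f f' h h').elim
    · exact (mixed f' f h.symm h'.symm).elim
    · exact congrArg Sum.inr (relCayley_wellLabelled L _ _ (hd.inr_injective hφ hΓ h) h')
  · rintro (f | ⟨c, x⟩)
    · exact ⟨_, LGraph.ini_mem_compV _,
        (hΓ.cover.covAt _ _ ⟨f, rfl, rfl⟩).map (glueInl φ Γ i L)⟩
    · obtain ⟨g, rfl⟩ := coset_surjective L c
      exact ⟨_, LGraph.ini_mem_compV _, ((isOrbitMap_coset L).covAt g).map (glueInr φ Γ i L)⟩

theorem GlueData.mem_VB (hd : GlueData φ Γ i L) (hφ : ∀ i, Function.Injective (φ i))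
    (hΓ : Good φ Γ.toLGraph) {d : (glueRelCayley φ Γ i L).V} (h : d ∈ (glueRelCayley φ Γ i L).VB) :
    ∃ a, d = (glueInl φ Γ i L).onV a ∧
      (a ∈ Γ.VB ∨ ∃ x, Act φ Γ.toLGraph i Γ.base (φ i x) a) := by
  obtain ⟨f | f, rfl, hc⟩ := h i
  · refine ⟨Γ.ini f, rfl, ?_⟩
    obtain ⟨f' | f', hf', hc'⟩ := h j
    · have := hd.inl_injective hφ hΓ hf'
      exact .inl (LGraph.mem_VB_of_ne hd.ne ⟨f, rfl, hc⟩ ⟨f', this, hc'⟩)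
    · obtain ⟨x, hx, -⟩ := hd.exists_of_inl_eq_inr hφ hΓ hf'.symm
      exact .inr ⟨x, hx⟩
  · exact absurd hc.symm hd.ne

theorem GlueData.noConflict (hd : GlueData φ Γ i L) (hφ : ∀ i, Function.Injective (φ i))
    (hΓ : Good φ Γ.toLGraph) : NoConflict φ (glueRelCayley φ Γ i L).toLGraph := by
  have key : ∀ d ∈ (glueRelCayley φ Γ i L).VB, ∀ x, ∃ b, ∀ k,
      Act φ (glueRelCayley φ Γ i L).toLGraph k d (φ k x) b := by
    intro d hdV x
    obtain ⟨a, rfl, ha | ⟨y, hy⟩⟩ := hd.mem_VB hφ hΓ hdV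
    · obtain ⟨b, hb⟩ := hΓ.cover.total hφ (ha 0) (φ 0 x)
      exact ⟨_, fun k => (hΓ.convert hφ k (ha k) hb).glueInl⟩
    · obtain ⟨b, hb⟩ := hΓ.cover.total hφ (hy.inc hd.inc) (φ i x)
      refine ⟨(glueInl φ Γ i L).onV b, fun k => ?_⟩
      obtain rfl | rfl : k = i ∨ k = j := by have := hd.ne; omega
      · exact hb.glueInl
      · have hyx := hy.trans hb
        rw [← map_mul] at hyx
        rw [glueInl_eq_glueInr hy, glueInl_eq_glueInr hyx, map_mul]
        exact act_glueInr hφ _ _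
  intro d hdV k l x b c _ hb hc
  obtain ⟨b', hb'⟩ := key d hdV x
  have hcov := hd.cover hφ hΓ
  exact (hcov.unique hφ hb (hb' k)).trans (hcov.unique hφ (hb' l) hc)

theorem glueRelCayley_connected (hφ : ∀ i, Function.Injective (φ i)) (hΓ : Γ.Connected) :
    (glueRelCayley φ Γ i L).Connected := by
  refine LGraph.connected_of_base ((glueInl φ Γ i L).onV Γ.base) ?_
  rintro ⟨a | c⟩
  · obtain ⟨w, hw⟩ := hΓ.2 Γ.base a
    exact ⟨w, hw.map (glueInl φ Γ i L)⟩
  · obtain ⟨g, rfl⟩ := coset_surjective L c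
    obtain ⟨w, hw, -⟩ := act_glueInr (Γ := Γ) (i := i) (L := L) hφ 1 g
    rw [one_mul, ← glueInl_base] at hw
    exact ⟨w, hw.1⟩

theorem GlueData.good (hd : GlueData φ Γ i L) (hφ : ∀ i, Function.Injective (φ i))
    (hΓ : Good φ Γ.toLGraph) : Good φ (glueRelCayley φ Γ i L).toLGraph where
  cover := hd.cover hφ hΓ
  gBased := (hd.cover hφ hΓ).gBased hφ (hd.noConflict hφ hΓ)
  connected := glueRelCayley_connected hφ hΓ.connected

theorem GlueData.base_act (hd : GlueData φ Γ i L) (hφ : ∀ i, Function.Injective (φ i)) : ∃ x, x ≠ 1 ∧ ∀ k, Act φ (glueRelCayley φ Γ i L).toLGraph k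
    (glueRelCayley φ Γ i L).base (φ k x) (glueRelCayley φ Γ i L).base := by
  obtain ⟨x, hx, hx1⟩ := hd.exists_ne
  have hi := ((hd.mem_iff x).1 hx).glueInl (i := i) (L := L)
  refine ⟨x, hx1, fun k => ?_⟩
  obtain rfl | rfl : k = i ∨ k = j := by have := hd.ne; omega
  · exact hi
  · have := act_glueInr (Γ := Γ) (i := i) (L := L) hφ 1 (φ k x)
    have h1 : coset L (1 * φ k x) = coset L 1 := by
      rw [coset_eq_iff]
      simpa using hx
    rw [h1, ← glueInl_base] at this
    exact this

theorem GlueData.base_mem_VB (hd : GlueData φ Γ i L) (hφ : ∀ i, Function.Injective (φ i)) :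
    (glueRelCayley φ Γ i L).base ∈ (glueRelCayley φ Γ i L).VB := by
  obtain ⟨x, hx, h⟩ := hd.base_act hφ
  exact fun k => (h k).ne_one_inc
    (fun h1 => hx (hφ k (h1.trans (map_one _).symm))) hφ

/-- The basepoint is now bichromatic, so there are two components. A component that misses it is an
old one away from the gluing, and its redundancy would have made it removable before. At the
basepoint both stabilizers contain a nontrivial element of `A`, which excludes the remaining case.
-/
theorem GlueData.not_redundant (hd : GlueData φ Γ i L) (hφ : ∀ i, Function.Injective (φ i))
    (hΓ : Good φ Γ.toLGraph) [Finite Γ.V] (hr : ∀ f, ¬ Removable φ Γ f)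
    (f : (glueRelCayley φ Γ i L).E) : ¬ Redundant φ (glueRelCayley φ Γ i L) f := by
  have hb := hd.base_mem_VB hφ
  have hG := hd.good hφ hΓ
  rintro (⟨h, -⟩ | ⟨-, t, ht, hs, ho, hbase⟩)
  · obtain ⟨f₀, -, h₀⟩ := hb 0
    obtain ⟨f₁, -, h₁⟩ := hb 1
    exact zero_ne_one (h₀.symm.trans ((h f₀).1.trans ((h f₁).1.symm.trans h₁)))
  rcases hbase with hbase | ⟨hbase, h1⟩
  · rcases f with f | ⟨c, x⟩
    · have hbf : Γ.base ∉ Γ.compV f := fun h => hbase (LGraph.compV_map (glueInl φ Γ i L) h)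
      obtain ⟨a, rfl, ha⟩ := hd.mem_VB hφ hΓ ht.2
      have haf : a ∈ Γ.compV f := by
        obtain ⟨g, hg⟩ := (mem_compV_iff (φ := φ)).1 ht.1
        obtain ⟨b, hb⟩ := hΓ.cover.total hφ ⟨f, rfl, rfl⟩ g
        obtain rfl := hd.inl_injective hφ hΓ (hG.cover.unique hφ hb.glueInl hg)
        exact mem_compV_iff.2 ⟨g, hb⟩
      have ha : a ∈ Γ.VB := by
        -- A vertex in the orbit of the basepoint is monochromatic of colour `i`, so the component
        -- of `f` would contain the basepoint.
        refine ha.resolve_right ?_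
        rintro ⟨x, hx⟩
        obtain ⟨f', hf', hc⟩ := LGraph.compV_inc haf
        have hfi : i = Γ.color f := (hd.mono_of_act hφ hΓ hx f' hf').symm.trans hc
        subst hfi
        exact hbf (hx.symm.mem_compV haf)
      -- The action already exists in the old graph, and its result is unique in the new one; so
      -- gluing changes nothing in this component.
      have back : ∀ g b, Act φ (glueRelCayley φ Γ i L).toLGraph (Γ.color f)
          ((glueInl φ Γ i L).onV a) g ((glueInl φ Γ i L).onV b) →
          Act φ Γ.toLGraph (Γ.color f) a g b := by
        intro g b h
        obtain ⟨b', hb'⟩ := hΓ.cover.total hφ (ha _) g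
        obtain rfl := hd.inl_injective hφ hΓ (hG.cover.unique hφ hb'.glueInl h)
        exact hb'
      refine hr f (hΓ.removable hφ ⟨haf, ha⟩ ?_ ?_ (.inl hbf))
      · intro g hg
        exact (monoLab_subset_amal_iff hφ).1 hs (mem_stab.2 (Act.glueInl hg))
      · intro b hb
        have hb' : (glueInl φ Γ i L).onV b ∈ (glueRelCayley φ Γ i L).compVB (.inl f) :=
          ⟨LGraph.compV_map (glueInl φ Γ i L) hb.1, fun k => LGraph.Inc.map (glueInl φ Γ i L) (hb.2 k)⟩
        rw [ho] at hb'
        obtain ⟨x, hx⟩ := (mem_orbit hφ).1 hb'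
        exact (mem_orbit hφ).2 ⟨x, back _ _ hx⟩
    · obtain ⟨g, rfl⟩ := coset_surjective L c
      refine hbase (mem_compV_iff (φ := φ).2 ⟨g⁻¹, ?_⟩)
      have := act_glueInr (Γ := Γ) (i := i) (L := L) hφ g g⁻¹
      rw [mul_inv_cancel, ← glueInl_base] at this
      exact this
  · obtain ⟨x, hx, h⟩ := hd.base_act hφ
    obtain ⟨g, hg⟩ := exists_act_of_mem_compV (φ := φ) ht.1 hbase.1
    rw [monoLab_eq_one_iff hφ, Subgroup.eq_bot_iff_forall] at h1
    -- Stabilizers along a component are conjugate, so a trivial one at `t` would force a trivial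
    -- one at the basepoint.
    have := h1 _ ((hg.trans (h _)).trans hg.symm)
    rw [conj_eq_one_iff] at this
    exact hx (hφ _ (this.trans (map_one _).symm))

theorem GlueData.isReducedPrecover (hd : GlueData φ Γ i L) (hφ : ∀ i, Function.Injective (φ i))
    (hΓ : Good φ Γ.toLGraph) [Finite Γ.V] (hr : ∀ f, ¬ Removable φ Γ f) :
    IsReducedPrecover φ (glueRelCayley φ Γ i L) where
  precover := (hd.good hφ hΓ).isPrecover hφ
  not_redundant := hd.not_redundant hφ hΓ hr
  base_cond f _ _ := (hd.good hφ hΓ).base_cond hφ (hd.base_mem_VB hφ) f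

theorem GlueData.sound (hd : GlueData φ Γ i L) (hφ : ∀ i, Function.Injective (φ i)) [∀ i, Finite (X i)] [∀ i, Finite (PresentedGroup (R i))]
    (h : Sound φ ws Γ) : Sound φ ws (glueRelCayley φ Γ i L) where
  finite_V :=
    have := h.finite_V
    have : Finite (Γ.disjUnion (relCayley L)).V :=
      inferInstanceAs (Finite (Γ.V ⊕ Quotient (QuotientGroup.rightRel L)))
    .of_surjective (Quot.mk _) Quot.mk_surjective
  finite_E :=
    have := h.finite_E
    inferInstanceAs (Finite (Γ.E ⊕ Quotient (QuotientGroup.rightRel L) × (X j × Bool)))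
  connected := glueRelCayley_connected hφ h.connected
  val_mem w hw := Lab.map (glueInl φ Γ i L) rfl (h.val_mem w hw)
  potential := by
    obtain ⟨p, hp, hp1⟩ := h.potential
    -- The potential is translated from the basepoint. It is well defined on cosets because elements
    -- of `L` lie in `A` and already fix the basepoint in colour `i`, hence fix its potential.
    let q : (relCayley L).V → PushoutI φ ⧸ inputSubgroup φ ws :=
      Quotient.lift (fun g => (PushoutI.of (φ := φ) j g)⁻¹ • p Γ.base) (by
        intro g h hgh
        have hL := QuotientGroup.rightRel_apply.1 hgh
        obtain ⟨x, hx⟩ := hd.le_range hL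
        rw [← hx, hd.mem_iff] at hL
        have h1 := hp.act hL
        rw [PushoutI.of_apply_eq_base, ← PushoutI.of_apply_eq_base φ j, hx, map_mul, map_inv,
          mul_smul] at h1
        change (PushoutI.of (φ := φ) j g)⁻¹ • p Γ.base = (PushoutI.of (φ := φ) j h)⁻¹ • p Γ.base
        rw [eq_inv_smul_iff, ← h1])
    have hq : ∀ g, q (coset L g) = (PushoutI.of (φ := φ) j g)⁻¹ • p Γ.base := fun _ => rfl
    refine ⟨Quot.lift (Sum.elim p q) ?_, ?_, hp1⟩
    · intro c d hcd
      obtain ⟨x, b, hx, rfl, rfl⟩ := glueRel_iff.1 hcd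
      change p b = q (coset L (φ j x))
      rw [hq, hp.act hx, PushoutI.of_apply_eq_base, PushoutI.of_apply_eq_base, inv_smul_smul]
    · rintro (f | ⟨c, x⟩)
      · exact hp f
      · obtain ⟨g, rfl⟩ := coset_surjective L c
        change q (coset L g) = val φ [letter j x] • q (coset L (g * genVal R x))
        rw [hq, hq, val_letter, smul_smul, map_mul, mul_inv_rev, mul_inv_cancel_left]

end GlueRel

/-! ### A single component with trivial stabilizer is a Cayley graph. -/

section EndOfStepFive

variable {X : Fin 2 → Type u} {R : ∀ i, Set (FreeGroup (X i))} {A : Type v} [Group A]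
  {φ : ∀ i, A →* PresentedGroup (R i)} {Γ : PGraph X}

open Monoid (PushoutI)

theorem isCayley_of_stab_eq_bot (hφ : ∀ i, Function.Injective (φ i)) (hΓ : Good φ Γ.toLGraph)
    {e : Γ.E} (he : ∀ f, f ∈ Γ.compE e) (hs : stab φ Γ.toLGraph (Γ.color e) Γ.base = ⊥) :
    IsCayley R Γ := by
  have hV : ∀ a, a ∈ Γ.compV e := by
    intro a
    obtain ⟨w, hw⟩ := hΓ.connected.2 (Γ.ini e) a
    refine ⟨w, hw, ?_⟩
    clear hs
    generalize Γ.ini e = b at hw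
    induction hw with
    | nil => simp
    | cons f _ ih => exact List.forall_mem_cons.2 ⟨(he f).1, ih⟩
  refine ⟨?_, Γ.color e, ?_⟩
  · refine Set.eq_empty_of_forall_notMem fun a ha => ?_
    obtain ⟨f, -, hf⟩ := ha (1 - Γ.color e)
    have := (he f).1
    omega
  · have hiso := hΓ.cover.compIso hφ (hV Γ.base)
    rw [hs] at hiso
    obtain ⟨f, hb, hf⟩ := hiso
    let f' : Γ.toLGraph.Iso (Γ.comp e) :=
      { onV := (Equiv.subtypeUnivEquiv hV).symm
        onE := (Equiv.subtypeUnivEquiv he).symm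
        ini_onE := fun _ => rfl
        rev_onE := fun _ => rfl
        lab_onE := fun _ => rfl }
    refine ⟨(f'.trans f).trans (cayleyIso _).symm, ?_⟩
    change (cayleyIso (Γ.color e)).onV.symm (f.onV ⟨Γ.base, hb⟩) = _
    rw [hf]
    exact (Equiv.symm_apply_eq _).2 rfl

end EndOfStepFive

/-! ### The invariant along executions, progress and termination. -/

section Execution

variable {X : Fin 2 → Type u} {R : ∀ i, Set (FreeGroup (X i))} {A : Type v} [Group A]
  {φ : ∀ i, A →* PresentedGroup (R i)} {ws : List (List (Letter X))} {Γ : PGraph X}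

open Monoid (PushoutI)

/-- The case in which step 6 glues nothing. A basepoint violating the last condition would be
monochromatic, and then the failed test says that its stabilizer meets `A` trivially. -/
theorem Good.isReducedPrecover (hφ : ∀ i, Function.Injective (φ i)) [Finite Γ.V]
    (hΓ : Good φ Γ.toLGraph) (hr : ∀ e, ¬ Removable φ Γ e) (hc : IsCayley R Γ → IsEmpty Γ.E)
    (hg : ∀ e (K : Subgroup (PresentedGroup (R (Γ.color e)))), ¬ NeedsGlue φ Γ e K) :
    IsReducedPrecover φ Γ where
  precover := hΓ.isPrecover hφ
  not_redundant e := by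
    rintro (⟨h, hs⟩ | ⟨-, t, ht, hs, ho, hb⟩)
    · exact (hc (isCayley_of_stab_eq_bot hφ hΓ h ((monoLab_eq_one_iff hφ).1 hs))).false e
    · exact hr e (hΓ.removable hφ ht ((monoLab_subset_amal_iff hφ).1 hs) ho.le
        (hb.imp_right fun h => ⟨h.1, (monoLab_eq_one_iff hφ).1 h.2⟩))
  base_cond e he hne := by
    refine hΓ.base_cond hφ ?_ e
    by_cases hm : Γ.Monochromatic (Γ.color e) Γ.base
    · refine absurd ⟨hm, hΓ.cover.compIso hφ he, fun hK => hne ?_⟩ (hg e _)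
      ext z
      rw [Set.mem_singleton_iff]
      constructor
      · rintro ⟨hz, hz'⟩
        obtain ⟨g, hgs, rfl⟩ := mem_monoLab.1 hz
        obtain ⟨x, rfl⟩ := (of_mem_amal_iff hφ).1 hz'
        rw [Subgroup.eq_bot_iff_forall] at hK
        rw [hK x hgs, map_one, map_one]
      · rintro rfl
        exact ⟨mem_monoLab.2 ⟨1, one_mem _, map_one _⟩, 1, map_one _⟩
    · simp only [LGraph.Monochromatic, not_forall] at hm
      obtain ⟨f, hf, hc⟩ := hm
      exact LGraph.mem_VB_of_ne hc ⟨f, hf, rfl⟩ (LGraph.compV_inc he)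

theorem exists_picksEdges (Γ : LGraph X) [Finite Γ.E] : ∃ L, PicksEdges Γ L := by
  let s : Setoid Γ.E :=
    { r := fun e f => f ∈ Γ.compE e
      iseqv := ⟨Γ.self_mem_compE, LGraph.mem_compE_symm, LGraph.mem_compE_trans⟩ }
  have := Fintype.ofFinite (Quotient s)
  have hs : ∀ q : Quotient s, ∀ e, q.out ∈ Γ.compE e ↔ q = Quotient.mk s e := by
    intro q e
    rw [eq_comm, ← Quotient.out_eq q, Quotient.eq]
    simp only [Quotient.out_eq]
    rfl
  let l := (Finset.univ : Finset (Quotient s)).toList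
  refine ⟨l.map Quotient.out, fun e => ?_⟩
  obtain ⟨k, hk⟩ := List.get_of_mem (Finset.mem_toList.2 (Finset.mem_univ (Quotient.mk s e)))
  refine ⟨Fin.cast (List.length_map _).symm k, ?_, fun k' hk' => ?_⟩
  · simp only [List.get_eq_getElem, List.getElem_map, Fin.val_cast]
    exact (hs _ e).2 hk
  · simp only [List.get_eq_getElem, List.getElem_map] at hk'
    have h1 := ((hs _ e).1 hk').trans hk.symm
    exact Fin.ext ((Finset.nodup_toList _).getElem_inj_iff.1 h1)

variable (φ ws) in
/-- The invariant of the configurations that are reached in an execution. -/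
def Config.Invariant : Config X → Prop
  | .step2 Γ => Sound φ ws Γ
  | .step3 Γ L => Sound φ ws Γ ∧ CoversOrListed R Γ.toLGraph L
  | .step4 Γ B => Sound φ ws Γ ∧ CoversOrListed R Γ.toLGraph [] ∧ ReachedFrom φ Γ.toLGraph B
  | .step5 Γ => Sound φ ws Γ ∧ Good φ Γ.toLGraph
  | .step6 Γ => Sound φ ws Γ ∧ Good φ Γ.toLGraph ∧ (∀ e, ¬ Removable φ Γ e) ∧
      (IsCayley R Γ → IsEmpty Γ.E)
  | .output Γ => Sound φ ws Γ ∧ IsReducedPrecover φ Γ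

theorem Transition.invariant [∀ i, Finite (X i)] [∀ i, Finite (PresentedGroup (R i))]
    (hφ : ∀ i, Function.Injective (φ i)) {c c' : Config X} (h : Transition φ c c')
    (hc : c.Invariant φ ws) : c'.Invariant φ ws := by
  cases h with
  | fold2 Γ e f h => exact Sound.fold hc h
  | cut2 Γ e h => exact Sound.cutHair hc h
  | end2 Γ hw hh L hL => exact ⟨hc, hL.coversOrListed⟩
  | fold3 Γ L e f h =>
    exact ⟨hc.1.fold h, hc.2.map (Γ.identEdgesHom e f h.lab_eq) Quot.mk_surjective⟩
  | glue3 Γ e L hw => exact ⟨hc.1.glueCayley hφ e, hc.2.glueCayley⟩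
  | end3 Γ hw => exact ⟨hc.1, hc.2, reachedFrom_VB _⟩
  | fold4 Γ B e f h =>
    exact ⟨hc.1.fold h, hc.2.1.map (Γ.identEdgesHom e f h.lab_eq) Quot.mk_surjective,
      hc.2.2.fold h⟩
  | identify4 Γ B c a b hcB h =>
    exact ⟨hc.1.identify h, hc.2.1.map (Γ.identVertsHom _) Function.surjective_id,
      hc.2.2.identify hcB h⟩
  | end4 Γ B hw h =>
    -- No edges remain listed, so every component has a vertex with an attached Cayley graph;
    -- well-labelledness spreads this to all its vertices.
    have hcov : Cover R Γ.toLGraph := .of_exists hw fun e => by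
      obtain ⟨a, ha, h⟩ := hc.2.1 e
      exact ⟨a, ha, h.resolve_right (by simp)⟩
    exact ⟨hc.1, hcov, hcov.gBased hφ (hc.2.2.noConflict h), hc.1.connected⟩
  | remove5 Γ e h =>
    have hs := hc.1.removeComp hφ hc.2 h (h.base_notMem φ)
    exact ⟨hs, hc.2.removeComp hφ _ hs.connected⟩
  | collapse5 Γ h hcay =>
    exact ⟨hc.1.trivial hcay, trivial_good, fun e => e.elim,
      fun _ => inferInstanceAs (IsEmpty PEmpty)⟩
  | end5 Γ h hcay => exact ⟨hc.1, hc.2, h, fun h => absurd h hcay⟩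
  | glue6 Γ e K h j hj =>
    have hd := h.glueData hφ hj
    have := hc.1.finite_V
    exact ⟨hd.sound hφ hc.1, hd.isReducedPrecover hφ hc.2.1 hc.2.2.1⟩
  | end6 Γ h =>
    have := hc.1.finite_V
    exact ⟨hc.1, hc.2.1.isReducedPrecover hφ hc.2.2.1 hc.2.2.2 h⟩

theorem Config.Invariant.progress {c : Config X} (hc : c.Invariant φ ws) :
    (∃ Γ, c = .output Γ) ∨ ∃ c', Transition φ c c' := by
  have hfold : ∀ Γ : PGraph X, ¬ Γ.WellLabelled → ∃ e f, Γ.Foldable e f := by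
    intro Γ h
    simp only [LGraph.WellLabelled, not_forall] at h
    obtain ⟨e, f, h₁, h₂, h₃⟩ := h
    exact ⟨e, f, h₃, h₁, h₂⟩
  cases c with
  | step2 Γ =>
    right
    by_cases hw : Γ.WellLabelled
    · by_cases hh : ∃ e, Γ.IsHair e
      · exact ⟨_, .cut2 Γ _ hh.choose_spec⟩
      · have := hc.finite_E
        obtain ⟨L, hL⟩ := exists_picksEdges Γ.toLGraph
        exact ⟨_, .end2 Γ hw (not_exists.1 hh) L hL⟩
    · obtain ⟨e, f, h⟩ := hfold Γ hw
      exact ⟨_, .fold2 Γ e f h⟩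
  | step3 Γ L =>
    right
    by_cases hw : Γ.WellLabelled
    · cases L with
      | nil => exact ⟨_, .end3 Γ hw⟩
      | cons e L => exact ⟨_, .glue3 Γ e L hw⟩
    · obtain ⟨e, f, h⟩ := hfold Γ hw
      exact ⟨_, .fold3 Γ L e f h⟩
  | step4 Γ B =>
    right
    by_cases hw : Γ.WellLabelled
    · by_cases h : ∀ c ∈ B, ∀ a b, ¬ Conflict φ Γ.toLGraph c a b
      · exact ⟨_, .end4 Γ B hw h⟩
      · simp only [not_forall, not_not] at h
        obtain ⟨c, hcB, a, b, h⟩ := h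
        exact ⟨_, .identify4 Γ B c a b hcB h⟩
    · obtain ⟨e, f, h⟩ := hfold Γ hw
      exact ⟨_, .fold4 Γ B e f h⟩
  | step5 Γ =>
    right
    by_cases h : ∃ e, Removable φ Γ e
    · exact ⟨_, .remove5 Γ _ h.choose_spec⟩
    · by_cases hcay : IsCayley R Γ
      · exact ⟨_, .collapse5 Γ (not_exists.1 h) hcay⟩
      · exact ⟨_, .end5 Γ (not_exists.1 h) hcay⟩
  | step6 Γ =>
    right
    by_cases h : ∀ e (K : Subgroup (PresentedGroup (R (Γ.color e)))), ¬ NeedsGlue φ Γ e K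
    · exact ⟨_, .end6 Γ h⟩
    · simp only [not_forall, not_not] at h
      obtain ⟨e, K, h⟩ := h
      exact ⟨_, .glue6 Γ e K h (1 - Γ.color e) (by omega)⟩
  | output Γ => exact .inl ⟨Γ, rfl⟩

/-- The number of vertices and edges. -/
noncomputable def PGraph.size (Γ : PGraph X) : ℕ := Nat.card Γ.V + Nat.card Γ.E

/-- Transitions decrease this quantity in the lexicographic order. -/
noncomputable def Config.rank : Config X → ℕ ×ₗ ℕ ×ₗ ℕ
  | .step2 Γ => toLex (5, toLex (0, Γ.size))
  | .step3 Γ L => toLex (4, toLex (L.length, Γ.size))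
  | .step4 Γ _ => toLex (3, toLex (0, Γ.size))
  | .step5 Γ => toLex (2, toLex (0, Γ.size))
  | .step6 Γ => toLex (1, toLex (0, Γ.size))
  | .output Γ => toLex (0, toLex (0, Γ.size))

theorem card_quot_lt {α : Type*} [Finite α] {r : α → α → Prop} {a b : α} (h : r a b)
    (hab : a ≠ b) : Nat.card (Quot r) < Nat.card α := by
  refine lt_of_le_of_ne (Nat.card_le_card_of_surjective _ Quot.mk_surjective) fun hc => hab ?_
  have : Function.Bijective (Quot.mk r) :=
    (Nat.bijective_iff_surjective_and_card _).2 ⟨Quot.mk_surjective, hc.symm⟩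
  exact this.1 (Quot.sound h)

theorem size_fold_lt (h : Sound φ ws Γ) {e f : Γ.E} (hef : Γ.Foldable e f) :
    (Γ.fold e f hef).size < Γ.size := by
  have := h.finite_V
  have := h.finite_E
  exact Nat.add_lt_add_of_le_of_lt (Nat.card_le_card_of_surjective _ Quot.mk_surjective)
    (card_quot_lt (Or.inl ⟨rfl, rfl⟩) hef.ne)

theorem size_identify_lt (h : Sound φ ws Γ) {a b : Γ.V} (hab : a ≠ b) :
    (Γ.identify a b).size < Γ.size := by
  have := h.finite_V
  exact Nat.add_lt_add_of_lt_of_le (card_quot_lt ⟨rfl, rfl⟩ hab) le_rfl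

theorem size_cutHair_lt (h : Sound φ ws Γ) {e : Γ.E} (he : Γ.IsHair e) :
    (Γ.cutHair e he).size < Γ.size := by
  have := h.finite_V
  have := h.finite_E
  exact Nat.add_lt_add_of_lt_of_le (Finite.card_subtype_lt (x := Γ.ter e) fun h => h rfl)
    (Finite.card_subtype_le _)

theorem size_removeComp_lt (h : Sound φ ws Γ) {e : Γ.E} (he : Γ.base ∉ Γ.compVM e) :
    (Γ.removeComp e he).size < Γ.size := by
  have := h.finite_V
  have := h.finite_E
  exact Nat.add_lt_add_of_le_of_lt (Finite.card_subtype_le _)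
    (Finite.card_subtype_lt (x := e) fun h => h (Γ.self_mem_compE e))

/-- The invariant enters through finiteness, without which `Nat.card` need not drop. Gluing in step
3 enlarges the graph but shortens the list, which is compared first; step 6 glues only while passing
to a lower stage. -/
theorem Transition.rank_lt {c c' : Config X} (h : Transition φ c c')
    (hc : c.Invariant φ ws) : c'.rank < c.rank := by
  have stage : ∀ {a b : ℕ} {x y : ℕ ×ₗ ℕ}, a < b → toLex (a, x) < toLex (b, y) := fun h =>
    Prod.Lex.toLex_lt_toLex.2 (.inl h)
  have size : ∀ {a b m n : ℕ}, m < n → toLex (a, toLex (b, m)) < toLex (a, toLex (b, n)) :=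
    fun h => Prod.Lex.toLex_lt_toLex.2 (.inr ⟨rfl, Prod.Lex.toLex_lt_toLex.2 (.inr ⟨rfl, h⟩)⟩)
  cases h with
  | fold2 Γ e f h => exact size (size_fold_lt hc h)
  | cut2 Γ e h => exact size (size_cutHair_lt hc h)
  | fold3 Γ L e f h =>
    simp only [Config.rank, List.length_map]
    exact size (size_fold_lt hc.1 h)
  | glue3 Γ e L hw =>
    exact Prod.Lex.toLex_lt_toLex.2 (.inr ⟨rfl, Prod.Lex.toLex_lt_toLex.2 (.inl (by simp))⟩)
  | fold4 Γ B e f h => exact size (size_fold_lt hc.1 h)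
  | identify4 Γ B c a b hcB h => exact size (size_identify_lt hc.1 h.1)
  | remove5 Γ e h => exact size (size_removeComp_lt hc.1 _)
  | _ => exact stage (by norm_num)

theorem Reachable.invariant [∀ i, Finite (X i)] [∀ i, Finite (PresentedGroup (R i))]
    (hφ : ∀ i, Function.Injective (φ i)) {c : Config X} (h : Reachable φ ws c) :
    c.Invariant φ ws := by
  induction h with
  | refl => exact sound_bouquet
  | tail _ h ih => exact h.invariant hφ ih

end Execution

end Stallings

theorem mainTheorem8 {X : Fin 2 → Type u} [∀ i, Finite (X i)]
    (R : ∀ i, Set (FreeGroup (X i))) (hR : ∀ i, (R i).Finite)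
    [∀ i, Finite (PresentedGroup (R i))]
    {A : Type v} [Group A] (φ : ∀ i, A →* PresentedGroup (R i))
    (hφ : ∀ i, Function.Injective (φ i))
    (ws : List (List (Stallings.Letter X))) :
    -- every execution is finite
    (¬ ∃ c : ℕ → Stallings.Config X, c 0 = Stallings.Config.start ws ∧
      ∀ n, Stallings.Transition φ (c n) (c (n + 1))) ∧
    -- no execution gets stuck before it has produced an output
    (∀ c, Stallings.Reachable φ ws c →
      (∃ Γ, c = .output Γ) ∨ ∃ c', Stallings.Transition φ c c') ∧
    -- every output is a finite reduced precover that determines the subgroup `H` generated by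
    -- the input
    (∀ Γ : Stallings.PGraph X, Stallings.Reachable φ ws (.output Γ) →
      Finite Γ.V ∧ Finite Γ.E ∧ Stallings.IsReducedPrecover φ Γ ∧
      Stallings.Lab φ Γ =
        (Subgroup.closure {g | ∃ w ∈ ws, Stallings.val φ w = g} :
          Set (Monoid.PushoutI φ))) := by
  refine ⟨?_, fun c hc => (hc.invariant hφ).progress, fun Γ hΓ => ?_⟩
  · rintro ⟨c, h0, hc⟩
    have hinv : ∀ n, (c n).Invariant φ ws := by
      intro n
      induction n with
      | zero => rw [h0]; exact Stallings.sound_bouquet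
      | succ n ih => exact (hc n).invariant hφ ih
    -- An infinite execution would give an infinite descending chain of ranks.
    exact (RelEmbedding.natGT (r := (· < ·)) (fun n => (c n).rank)
      fun n => (hc n).rank_lt (hinv n)).not_wellFounded wellFounded_lt
  · obtain ⟨hs, hr⟩ := hΓ.invariant hφ
    exact ⟨hs.finite_V, hs.finite_E, hr, hs.lab_eq⟩
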